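/- Let \(F:\mathbb R^3\to\mathbb R\) be \(C^\infty\) and suppose that \(\Gamma=\{x\in\mathbb R^3: F(x)=0\}\) is non-empty and compact and that \(\nabla F\neq 0\) on \(\Gamma\), so that \(\Gamma\) is a smooth compact surface. Let \(\kappa_1(x),\kappa_2(x)\) be its principal curvatures at \(x\in\Gamma\), put \(K_\Gamma=\frac12\max_{x\in\Gamma}(|\kappa_1(x)|+|\kappa_2(x)|)\), and let the reach \(r_\Gamma\) be the supremum of all \(r\ge 0\) such that every \(x\in\mathbb R^3\) with \(d(x,\Gamma)\le r\) has exactly one nearest point in \(\Gamma\). Let \(T\) be a tetrahedral mesh, consisting of finitely many non-degenerate tetrahedra \(T_1,\dots,T_N\), with \(h_T=\max_i\operatorname{diam}(T_i)\). Suppose that \(T\) is \(\eta\)-consistent with \(\Gamma\), that is, \(h_T\le r_\Gamma\) and every vertex of \(T\) has distance at least \(\eta h_T\) from \(\Gamma\), and that \(\eta>K_\Gamma h_T\). Then each tetrahedron \(T_i\) is, up to the labelling of its vertices, in one of the following three cases, and for every labelling \(T_i=A_0A_1A_2A_3\): (1) If \(F(A_0),F(A_1),F(A_2),F(A_3)\)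 all have the same sign (all positive or all negative), then \(\Gamma\cap T_i=\emptyset\). (2) If \(F(A_0)>0\) and \(F(A_1),F(A_2),F(A_3)<0\), or with all signs reversed, then for every \(P\in\triangle A_1A_2A_3\) the segment \(\overline{A_0P}\) meets \(\Gamma\) in exactly one point. (3) If \(F(A_0),F(A_1)>0\) and \(F(A_2),F(A_3)<0\), or with all signs reversed, then the edge \(\overline{A_0A_2}\) meets \(\Gamma\) in exactly one point \(B\); for every \(P\in\triangle BA_1A_3\) the segments \(\overline{A_0P}\) and \(\overline{A_2P}\) together meet \(\Gamma\) exactly once, i.e. \((\overline{A_0P}\cup\overline{PA_2})\cap\Gamma\) is a single point; and in each of the two sub-tetrahedra \(A_0A_1BA_3\) and \(A_2A_1BA_3\) the segments from one vertex to the opposite face cross \(\Gamma\) as in (2): for every \(P\in\triangle A_0A_1B\) the segment \(\overline{A_3P}\), and for every \(P\in\triangle BA_2A_3\) the segment \(\overline{A_1P}\), meets \(\Gamma\) in exactly one point. -/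

import Mathlib

noncomputable section

namespace ImplicitSurface

/-- Euclidean three-space. -/
abbrev E3 : Type := EuclideanSpace ℝ (Fin 3)

/-- The level set `Γ = {x | F x = 0}`. -/
def zeroSet (F : E3 → ℝ) : Set E3 := {x | F x = 0}

/-- `Γ = {F = 0}` is a smooth compact surface with smooth defining function `F`:
`F` is `C^∞`, its zero set is compact and non-empty, and `0` is a regular value of `F`. -/
structure IsSmoothCompactSurface (F : E3 → ℝ) : Prop where
  smooth : ContDiff ℝ (⊤ : ℕ∞) F
  compact : IsCompact (zeroSet F)
  nonempty : (zeroSet F).Nonempty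
  regular : ∀ x ∈ zeroSet F, gradient F x ≠ 0

/-- The unit normal field `∇F / ‖∇F‖`. -/
def unitNormal (F : E3 → ℝ) (x : E3) : E3 := ‖gradient F x‖⁻¹ • gradient F x

/-- The tangent plane of the level set of `F` through `x`, i.e. the orthogonal complement
of `∇F x`. -/
abbrev tangentPlane (F : E3 → ℝ) (x : E3) : Submodule ℝ E3 := (Submodule.span ℝ {gradient F x})ᗮ

/-- The shape operator (Weingarten map) `v ↦ -Dn(v)` of the tangent plane. The orthogonal
projection only serves to land in the tangent plane: `Dn(v)` is tangent already, as `‖n‖ = 1`. -/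
def shapeOperator (F : E3 → ℝ) (x : E3) : tangentPlane F x →ₗ[ℝ] tangentPlane F x :=
  -((tangentPlane F x).orthogonalProjectionOnto.toLinearMap ∘ₗ
    (fderiv ℝ (unitNormal F) x).toLinearMap ∘ₗ (tangentPlane F x).subtype)

/-- The principal curvatures `κ₁, κ₂` at `x`: the eigenvalues of the shape operator, with
multiplicity. -/
def principalCurvatures (F : E3 → ℝ) (x : E3) : Multiset ℝ :=
  (shapeOperator F x).charpoly.roots

/-- `K_Γ = (1/2) max_{x ∈ Γ} (|κ₁(x)| + |κ₂(x)|)`. -/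
def curvatureBound (F : E3 → ℝ) : ℝ :=
  (1 / 2) * sSup ((fun x => ((principalCurvatures F x).map fun κ => |κ|).sum) '' zeroSet F)

/-- The reach of `M`: the supremum of all `r` such that every point at distance at most `r` from
`M` has exactly one nearest point in `M`. -/
def reach (M : Set E3) : ENNReal :=
  sSup {r | ∀ x : E3, Metric.infEDist x M ≤ r → ∃! y, y ∈ M ∧ edist x y = Metric.infEDist x M}

/-- A tetrahedral mesh: a finite family of (non-degenerate) tetrahedra. How they fit together
is left free, so that face-to-face meshes are a special case. -/
abbrev TetMesh (N : ℕ) : Type := Fin N → Affine.Simplex ℝ E3 3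

/-- A tetrahedron as a point set. -/
def body (t : Affine.Simplex ℝ E3 3) : Set E3 := convexHull ℝ (Set.range t.points)

/-- `h_T`, the largest diameter of a tetrahedron of the mesh. -/
def meshSize {N : ℕ} (T : TetMesh N) : ℝ := ⨆ i, Metric.diam (body (T i))

/-- The mesh `T` is `η`-consistent with `Γ`: `h_T` is at most the reach of `Γ`, and every vertex
of the mesh has distance at least `η h_T` from `Γ`. -/
def IsConsistent {N : ℕ} (η : ℝ) (T : TetMesh N) (M : Set E3) : Prop :=
  ENNReal.ofReal (meshSize T) ≤ reach M ∧
    ∀ i j, η * meshSize T ≤ Metric.infDist ((T i).points j) M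

/-- All four vertex values have the same sign. -/
def AllSame (F : E3 → ℝ) (A : Fin 4 → E3) : Prop :=
  (∀ j, 0 < F (A j)) ∨ (∀ j, F (A j) < 0)

/-- The sign at `A 0` is opposite to the sign at `A 1`, `A 2`, `A 3`. -/
def OneThree (F : E3 → ℝ) (A : Fin 4 → E3) : Prop :=
  (0 < F (A 0) ∧ F (A 1) < 0 ∧ F (A 2) < 0 ∧ F (A 3) < 0) ∨
    (F (A 0) < 0 ∧ 0 < F (A 1) ∧ 0 < F (A 2) ∧ 0 < F (A 3))

/-- The sign at `A 0`, `A 1` is opposite to the sign at `A 2`, `A 3`. -/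
def TwoTwo (F : E3 → ℝ) (A : Fin 4 → E3) : Prop :=
  (0 < F (A 0) ∧ 0 < F (A 1) ∧ F (A 2) < 0 ∧ F (A 3) < 0) ∨
    (F (A 0) < 0 ∧ F (A 1) < 0 ∧ 0 < F (A 2) ∧ 0 < F (A 3))

/-- The set `s` meets the set `M` in exactly one point. -/
def MeetsOnce (s M : Set E3) : Prop := ∃! x, x ∈ s ∩ M

end ImplicitSurface

end

open ImplicitSurface

/-!
# Crossing a smooth compact surface along the segments of a consistent mesh

Everything follows from one transversality property (`inner_gradient_pos`): if `F A > 0`, if `A` has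
distance at most `h` from a point `x` of the surface `Γ`, and if the distance of `A` to `Γ` exceeds
`K h²`, then `A` lies strictly above the tangent plane of `Γ` at `x`. It applies to every vertex of
a consistent mesh and, through `-F`, to the vertices with `F < 0`. Hence `Γ` crosses each
tetrahedron in a controlled direction. A point of `Γ` in the hull of positive vertices would lie
strictly above its own tangent plane, so there is none; along a segment starting at a positive
vertex, `F` decreases strictly through each of its zeros, so it has at most one. The conditions are
open half-space conditions, so they pass to convex hulls of vertices, and the cases of the theorem
become intermediate value arguments.

For the transversality property, suppose that `A` is not above the tangent plane at `x`. Then `A` is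
at most `√(h² + R²)` away from the centre of the ball of radius `R` that touches `Γ` at `x` from the
side `F < 0`. It remains to see that the distance `φ` of `A` to `Γ` is at most the distance to this
ball, for suitable `R`; this gives `φ ≤ h² / (2R)`.

* If `2 K h ≥ 1`, the choice `R = h` is good enough. That the ball of radius `h` is free of points
  of `Γ` (`infDist_inner_normal`) is a consequence of the uniqueness of nearest points at distance
  less than `h`, by prolonging the normal ray (`infDist_extend`).
* If `2 K h < 1`, some `R ≥ h` slightly below `1 / (2 K)` is used. The ball may then meet distant
  parts of `Γ`, but all normal curvatures are at most `2 K`, so that balls of radius `R` touch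
  locally from one side (`eventually_neg_of_mem_touching_ball`). Together with the uniqueness of
  nearest points this makes the function `(φ + R)² - |·|²` of the signed distance `φ` concave along
  the segment from `x` to `A`, in the weak sense that it has affine local upper supports
  (`signedSurfaceDist_le_near`). A minimum principle (`le_affine_of_local_support`) turns the
  estimate near `x` into the estimate at `A`. No smoothness of the distance function is needed.
-/

open Metric Set Filter Topology
open ImplicitSurface

/-! ### Nearest points and normal rays -/

/-- Every point at distance less than `h` from `M` has exactly one nearest point in `M`. -/
def UniqueNearest {X : Type*} [PseudoMetricSpace X] (M : Set X) (h : ℝ) : Prop :=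
  ∀ x, infDist x M < h → ∃! y, y ∈ M ∧ dist x y = infDist x M

/-- Nearest points depend continuously on the point wherever they are unique. -/
theorem eventually_nearest_mem {X : Type*} [PseudoMetricSpace X] {M : Set X} (hM : IsCompact M)
    {y z : X} (huniq : ∀ y' ∈ M, dist z y' = infDist z M → y' = y) {U : Set X}
    (hU : U ∈ 𝓝 y) :
    ∀ᶠ z' in 𝓝 z, ∀ y' ∈ M, dist z' y' = infDist z' M → y' ∈ U := by
  obtain ⟨V, hVU, hVo, hyV⟩ := _root_.mem_nhds_iff.1 hU
  have hC : IsCompact (M \ V) := hM.diff hVo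
  rcases (M \ V).eq_empty_or_nonempty with he | hne
  · refine Eventually.of_forall fun z' y' hy' _ => hVU ?_
    by_contra hcon
    exact (he ▸ (⟨hy', hcon⟩ : y' ∈ M \ V) : y' ∈ (∅ : Set X))
  obtain ⟨q, hq, hqd⟩ := hC.exists_infDist_eq_dist hne z
  have hlt : infDist z M < infDist z (M \ V) := by
    refine lt_of_le_of_ne (infDist_le_infDist_of_subset sdiff_subset hne) fun heq => ?_
    exact hq.2 (huniq q hq.1 (by rw [← hqd, heq]) ▸ hyV)
  filter_upwards [ball_mem_nhds z (half_pos (sub_pos.2 hlt))] with z' hz' y' hy' hd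
  refine hVU ?_
  by_contra hcon
  have h1 : infDist z (M \ V) ≤ dist z y' := infDist_le_dist_of_mem ⟨hy', hcon⟩
  have h2 : infDist z' M ≤ infDist z M + dist z' z := infDist_le_infDist_add_dist
  have h3 := dist_triangle z z' y'
  rw [mem_ball] at hz'
  rw [dist_comm z z'] at h3
  linarith

section NormalRays

variable {E : Type*} [NormedAddCommGroup E] [InnerProductSpace ℝ E]

/-- A unit-speed normal ray along which the distance to `M` grows at unit speed can be prolonged
as long as nearest points stay unique. A point `x` that maximizes the distance to `M` on the closed
ball of radius `ε` about `z` sees its nearest point in the direction of `z`, because otherwise the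
distance would increase along a direction pointing into the ball; so `x` lies on the ray. -/
theorem infDist_extend [FiniteDimensional ℝ E] {M : Set E} (hM : IsCompact M) {h : ℝ}
    (hu : UniqueNearest M h) {y z : E} (hy : y ∈ M) (hyz : dist z y = infDist z M)
    (hpos : 0 < infDist z M) {ε : ℝ} (hε : 0 < ε) (hεd : ε ≤ infDist z M)
    (hεh : infDist z M + ε < h) :
    infDist (z + (ε / infDist z M) • (z - y)) M = infDist z M + ε := by
  have hMne : M.Nonempty := ⟨y, hy⟩
  obtain ⟨x, hx, hmax⟩ := (isCompact_closedBall z ε).exists_isMaxOn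
    ⟨z, mem_closedBall_self hε.le⟩ (continuous_infDist_pt M).continuousOn
  have hxz : infDist z M ≤ infDist x M := hmax (mem_closedBall_self hε.le)
  have hxh : infDist x M < h := by
    have : infDist x M ≤ infDist z M + dist x z := infDist_le_infDist_add_dist
    have := mem_closedBall.1 hx
    linarith
  obtain ⟨p, ⟨hp, hpd⟩, hpu⟩ := hu x hxh
  -- the distance increases in every direction that points away from the nearest point
  have hinc : ∀ v : E, 0 < inner ℝ v (x - p) →
      ∀ᶠ t in 𝓝[>] (0 : ℝ), infDist x M < infDist (x + t • v) M := by
    intro v hv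
    have hU : {q : E | 0 < inner ℝ v (x - q)} ∈ 𝓝 p := by
      refine (isOpen_lt continuous_const ?_).mem_nhds hv
      fun_prop
    have hev := eventually_nearest_mem hM (fun y' h1 h2 => hpu y' ⟨h1, h2⟩) hU
    have hc : Tendsto (fun t : ℝ => x + t • v) (𝓝[>] 0) (𝓝 x) := by
      have : Continuous fun t : ℝ => x + t • v := by fun_prop
      have h0 := this.tendsto 0
      simp only [zero_smul, add_zero] at h0
      exact h0.mono_left nhdsWithin_le_nhds
    filter_upwards [hc.eventually hev, self_mem_nhdsWithin] with t ht (ht0 : 0 < t)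
    obtain ⟨q, hq, hqd⟩ := hM.exists_infDist_eq_dist hMne (x + t • v)
    have hvq : 0 < inner ℝ v (x - q) := ht q hq hqd.symm
    have h1 : infDist x M ≤ ‖x - q‖ := by
      rw [← dist_eq_norm]; exact infDist_le_dist_of_mem hq
    rw [hqd, dist_eq_norm]
    have h2 : ‖x + t • v - q‖ ^ 2 = ‖x - q‖ ^ 2 + 2 * (t * inner ℝ v (x - q)) + ‖t • v‖ ^ 2 := by
      rw [show x + t • v - q = (x - q) + t • v by abel, norm_add_sq_real, real_inner_smul_right,
        real_inner_comm]
    refine lt_of_le_of_lt h1 (lt_of_pow_lt_pow_left₀ 2 (norm_nonneg _) ?_)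
    nlinarith [mul_pos ht0 hvq, sq_nonneg ‖t • v‖]
  have hup : ‖x - p‖ = infDist x M := by rw [← dist_eq_norm, hpd]
  have hup0 : 0 < ‖x - p‖ := by rw [hup]; linarith
  -- no direction of increase points into the ball
  have hin : ∀ v : E, 0 < inner ℝ v (x - p) →
      ¬ ∀ᶠ t in 𝓝[>] (0 : ℝ), x + t • v ∈ closedBall z ε := by
    intro v hv hcon
    obtain ⟨t, ht1, ht2⟩ := ((hinc v hv).and hcon).exists
    exact absurd (hmax ht2) (not_le.2 ht1)
  have hw : ‖x - z‖ = ε := by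
    refine le_antisymm (by rw [← dist_eq_norm]; exact hx) (not_lt.1 fun hlt => ?_)
    refine hin (x - p) (by rw [real_inner_self_eq_norm_sq]; positivity) ?_
    have hc : Continuous fun t : ℝ => x + t • (x - p) := by fun_prop
    have : ∀ᶠ t in 𝓝 (0 : ℝ), x + t • (x - p) ∈ ball z ε :=
      hc.continuousAt.preimage_mem_nhds
        (isOpen_ball.mem_nhds (by simpa [mem_ball, dist_eq_norm] using hlt))
    exact (this.filter_mono nhdsWithin_le_nhds).mono fun t ht => ball_subset_closedBall ht
  have hpar : ‖x - p‖ * ε ≤ inner ℝ (x - p) (x - z) := by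
    by_contra! hcon
    set v : E := ε • (x - p) - ‖x - p‖ • (x - z) with hv
    have hv1 : 0 < inner ℝ v (x - p) := by
      rw [hv, inner_sub_left, real_inner_smul_left, real_inner_smul_left,
        real_inner_self_eq_norm_sq, real_inner_comm]
      nlinarith
    have hv2 : inner ℝ (x - z) v < 0 := by
      rw [hv, inner_sub_right, real_inner_smul_right, real_inner_smul_right,
        real_inner_self_eq_norm_sq, real_inner_comm, hw]
      nlinarith
    refine hin v hv1 ?_
    have hc : ∀ᶠ t in 𝓝 (0 : ℝ), 2 * inner ℝ (x - z) v + t * ‖v‖ ^ 2 < 0 := by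
      refine (isOpen_lt (by fun_prop) continuous_const).mem_nhds ?_
      simpa using mul_neg_of_pos_of_neg two_pos hv2
    filter_upwards [hc.filter_mono nhdsWithin_le_nhds, self_mem_nhdsWithin] with t ht (ht0 : 0 < t)
    rw [mem_closedBall, dist_eq_norm]
    refine le_of_sq_le_sq ?_ hε.le
    rw [show x + t • v - z = (x - z) + t • v by abel, norm_add_sq_real, real_inner_smul_right,
      norm_smul, Real.norm_of_nonneg ht0.le, hw]
    nlinarith
  have heq : ε • (x - p) = ‖x - p‖ • (x - z) := by
    have h1 : inner ℝ (x - p) (x - z) = ‖x - p‖ * ‖x - z‖ :=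
      le_antisymm (real_inner_le_norm _ _) (by rw [hw]; exact hpar)
    have := inner_eq_norm_mul_iff_real.1 h1
    rw [hw] at this
    exact this
  -- hence `z` lies between `x` and its nearest point
  have hzp : z - p = (1 - ε / ‖x - p‖) • (x - p) := by
    have : x - z = (ε / ‖x - p‖) • (x - p) := by
      rw [div_eq_inv_mul, mul_smul, heq, smul_smul, inv_mul_cancel₀ hup0.ne', one_smul]
    rw [sub_smul, one_smul, ← this]; abel
  have hle : 0 ≤ 1 - ε / ‖x - p‖ := by
    rw [sub_nonneg, div_le_one hup0, hup]; linarith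
  have hnzp : ‖z - p‖ = infDist x M - ε := by
    rw [hzp, norm_smul, Real.norm_of_nonneg hle, hup]
    rw [hup] at hup0
    field_simp
  have h1 : infDist z M ≤ ‖z - p‖ := by
    rw [← dist_eq_norm]; exact infDist_le_dist_of_mem hp
  have h2 : infDist x M ≤ infDist z M + dist x z := infDist_le_infDist_add_dist
  rw [dist_eq_norm, hw] at h2
  have h3 : ‖z - p‖ = infDist z M := by linarith
  obtain ⟨y', _, hy'u⟩ := hu z (by linarith)
  have hpy : p = y := (hy'u p ⟨hp, by rw [dist_eq_norm, h3]⟩).trans (hy'u y ⟨hy, hyz⟩).symm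
  subst hpy
  have hxe : z + (ε / infDist z M) • (z - p) = x := by
    have hd : infDist z M = ‖x - p‖ - ε := by linarith
    have hne : ‖x - p‖ - ε ≠ 0 := by linarith
    rw [hzp, smul_smul, hd]
    have : ε / (‖x - p‖ - ε) * (1 - ε / ‖x - p‖) = ε / ‖x - p‖ := by
      field_simp
    rw [this]
    have h4 : z = p + (1 - ε / ‖x - p‖) • (x - p) := by rw [← hzp]; abel
    nth_rewrite 1 [h4]
    module
  rw [hxe]
  linarith

/-- If the distance to `M` grows at unit speed at the start of a normal ray, it does so up to
the distance `h` below which nearest points are unique. -/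
theorem infDist_ray [FiniteDimensional ℝ E] {M : Set E} (hM : IsCompact M) {h : ℝ}
    (hu : UniqueNearest M h) {y e : E} (hy : y ∈ M) (he : ‖e‖ = 1) {s₀ : ℝ} (hs₀ : 0 < s₀)
    (hs₀h : s₀ ≤ h) (hstart : infDist (y + s₀ • e) M = s₀) : infDist (y + h • e) M = h := by
  set S : Set ℝ := {s | s ∈ Icc s₀ h ∧ infDist (y + s • e) M = s} with hS
  have hScl : IsClosed S := by
    refine isClosed_Icc.inter (isClosed_eq ?_ continuous_id)
    exact (continuous_infDist_pt M).comp (by fun_prop)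
  have hSc : IsCompact S := isCompact_Icc.of_isClosed_subset hScl fun s hs => hs.1
  obtain ⟨s, hs, hsmax⟩ := hSc.exists_isGreatest ⟨s₀, ⟨le_rfl, hs₀h⟩, hstart⟩
  obtain ⟨⟨hs1, hs2⟩, hsd⟩ := hs
  rcases hs2.eq_or_lt with rfl | hlt
  · exact hsd
  exfalso
  have hspos : 0 < s := hs₀.trans_le hs1
  set ε := min s ((h - s) / 2) with hε
  have hε0 : 0 < ε := lt_min hspos (by linarith)
  have hε1 : ε ≤ s := min_le_left _ _
  have hε2 : ε ≤ (h - s) / 2 := min_le_right _ _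
  have hdist : dist (y + s • e) y = infDist (y + s • e) M := by
    rw [hsd, dist_eq_norm, add_sub_cancel_left, norm_smul, he, Real.norm_of_nonneg hspos.le,
      mul_one]
  have := infDist_extend hM hu hy hdist (by rw [hsd]; exact hspos) hε0 (by rw [hsd]; exact hε1)
    (by rw [hsd]; linarith)
  rw [hsd, add_sub_cancel_left, smul_smul, div_mul_cancel₀ _ hspos.ne', add_assoc,
    ← add_smul] at this
  have hmem : s + ε ∈ S := ⟨⟨by linarith, by linarith⟩, this⟩
  linarith [hsmax hmem]

end NormalRays

/-! ### A minimum principle on an interval -/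

/-- A continuous function on `[0, 1]` that near each `t < 1` lies below an affine function touching
it at `t` lies below its supporting line at `0`; only the value at `1` is recorded. -/
theorem le_affine_of_local_support {u : ℝ → ℝ} (hu : ContinuousOn u (Icc 0 1))
    (hs : ∀ t ∈ Ioo (0 : ℝ) 1, ∃ a : ℝ, ∀ᶠ s in 𝓝 t, u s ≤ u t + a * (s - t))
    {a : ℝ} (h0 : ∀ᶠ s in 𝓝[>] (0 : ℝ), u s ≤ u 0 + a * s) : u 1 ≤ u 0 + a := by
  by_contra! hcon
  set δ := (u 1 - (u 0 + a)) / 2 with hδ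
  have hδ0 : 0 < δ := by rw [hδ]; linarith
  -- after a small tilt there is a negative interior minimum
  set w : ℝ → ℝ := fun s => u s - u 0 - (a + δ) * s with hw
  have hwc : ContinuousOn w (Icc 0 1) := by
    rw [hw]; fun_prop
  obtain ⟨t₀, ht₀, ht₀0, ht₀1⟩ :=
    (h0.and (Ioo_mem_nhdsGT one_pos)).exists
  have hw0 : w 0 = 0 := by simp [hw]
  have hw1 : 0 < w 1 := by simp only [hw]; linarith
  have hwt : w t₀ < 0 := by simp only [hw]; nlinarith [mul_pos hδ0 ht₀0]
  obtain ⟨m, hm, hmin⟩ := isCompact_Icc.exists_isMinOn ⟨0, by simp⟩ hwc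
  have hmneg : w m < 0 := (hmin (show t₀ ∈ Icc (0 : ℝ) 1 from ⟨ht₀0.le, ht₀1.le⟩)).trans_lt hwt
  have hSc : IsCompact {t | t ∈ Icc (0 : ℝ) 1 ∧ w t = w m} := by
    refine isCompact_Icc.of_isClosed_subset ?_ fun t ht => ht.1
    exact hwc.preimage_isClosed_of_isClosed isClosed_Icc isClosed_singleton
  obtain ⟨t, ⟨htI, htw⟩, hleast⟩ := hSc.exists_isLeast ⟨m, hm, rfl⟩
  have ht0 : 0 < t := by
    refine lt_of_le_of_ne htI.1 fun h => ?_
    rw [← h, hw0] at htw; linarith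
  have ht1 : t < 1 := by
    refine lt_of_le_of_ne htI.2 fun h => ?_
    rw [h] at htw; linarith
  obtain ⟨b, hb⟩ := hs t ⟨ht0, ht1⟩
  obtain ⟨r, hr, hball⟩ := Metric.eventually_nhds_iff.1 (hb.and (Ioo_mem_nhds ht0 ht1))
  have hkey : ∀ s, |s - t| < r → w t ≤ w s ∧ w s ≤ w t + (b - a - δ) * (s - t) := by
    intro s hsr
    obtain ⟨h1, h2⟩ := hball (show dist s t < r from hsr)
    refine ⟨by rw [htw]; exact hmin (show s ∈ Icc (0 : ℝ) 1 from ⟨h2.1.le, h2.2.le⟩), ?_⟩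
    simp only [hw]; linarith
  have hL := hkey (t - r / 2) (by rw [abs_lt]; constructor <;> linarith)
  have hR := hkey (t + r / 2) (by rw [abs_lt]; constructor <;> linarith)
  have hslope : b - a - δ = 0 := by
    apply le_antisymm <;> by_contra! hne <;> nlinarith [hL.1, hL.2, hR.1, hR.2]
  have hwL : w (t - r / 2) = w m := by
    rw [hslope] at hL; linarith [hL.1, hL.2]
  have hmem := (hball (show dist (t - r / 2) t < r by
    rw [Real.dist_eq, abs_lt]; constructor <;> linarith)).2
  linarith [hleast ⟨⟨hmem.1.le, hmem.2.le⟩, hwL⟩]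

/-! ### Second-order expansion of the defining function -/

section Gradient

variable {F : E3 → ℝ}

theorem contDiff_gradient (hF : ContDiff ℝ (⊤ : ℕ∞) F) : ContDiff ℝ (⊤ : ℕ∞) (gradient F) :=
  (InnerProductSpace.toDual ℝ E3).symm.toContinuousLinearEquiv.contDiff.comp
    (hF.fderiv_right (by simp))

theorem gradient_neg (F : E3 → ℝ) : gradient (-F) = -gradient F := by
  funext x
  simp [gradient, fderiv_neg]

theorem fderiv_fderiv_apply (hF : ContDiff ℝ (⊤ : ℕ∞) F) (x v w : E3) :
    fderiv ℝ (fderiv ℝ F) x v w = inner ℝ (fderiv ℝ (gradient F) x v) w := by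
  have hG : DifferentiableAt ℝ (gradient F) x := (contDiff_gradient hF).differentiable (by simp) x
  have h : fderiv ℝ F = fun y => InnerProductSpace.toDual ℝ E3 (gradient F y) := by
    funext y; simp [gradient]
  rw [h]
  have := ((InnerProductSpace.toDual ℝ E3).toContinuousLinearEquiv.toContinuousLinearMap.hasFDerivAt
    (x := gradient F x)).comp x hG.hasFDerivAt
  have h2 : fderiv ℝ (fun y => InnerProductSpace.toDual ℝ E3 (gradient F y)) x = _ := this.fderiv
  rw [h2]
  simp

/-- The Hessian, read as the derivative of the gradient field, is symmetric. -/
theorem inner_fderiv_gradient_comm (hF : ContDiff ℝ (⊤ : ℕ∞) F) (x v w : E3) :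
    inner ℝ (fderiv ℝ (gradient F) x v) w = inner ℝ (fderiv ℝ (gradient F) x w) v := by
  rw [← fderiv_fderiv_apply hF, ← fderiv_fderiv_apply hF]
  exact (hF.contDiffAt.isSymmSndFDerivAt
    (by rw [minSmoothness_of_isRCLikeNormedField]; exact WithTop.coe_le_coe.2 le_top)).eq v w

/-- Second-order Taylor estimate. -/
theorem eventually_taylor (hF : ContDiff ℝ (⊤ : ℕ∞) F) (y : E3) {ε : ℝ} (hε : 0 < ε) :
    ∀ᶠ z in 𝓝 y, |F z - F y - inner ℝ (gradient F y) (z - y)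
      - inner ℝ (fderiv ℝ (gradient F) y (z - y)) (z - y) / 2| ≤ ε * ‖z - y‖ ^ 2 := by
  have hFd : Differentiable ℝ F := hF.differentiable (by simp)
  have hGd : DifferentiableAt ℝ (gradient F) y := (contDiff_gradient hF).differentiable (by simp) y
  set H := fderiv ℝ (gradient F) y with hH
  set Ψ : E3 → ℝ := fun w => F w - F y - inner ℝ (gradient F y) (w - y)
    - inner ℝ (H (w - y)) (w - y) / 2 with hΨ
  have hder : ∀ w, HasFDerivAt Ψ
      (InnerProductSpace.toDual ℝ E3 (gradient F w - gradient F y - H (w - y))) w := by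
    intro w
    have hsub : HasFDerivAt (fun w : E3 => w - y) (ContinuousLinearMap.id ℝ E3) w :=
      (hasFDerivAt_id w).sub_const y
    have h1 := (hFd w).hasFDerivAt.sub_const (F y)
    have h2 := (hasFDerivAt_const (gradient F y) w).inner ℝ hsub
    have h3 := (((H.hasFDerivAt.comp w hsub).inner ℝ hsub).mul_const (1 / 2 : ℝ))
    have h4 := (h1.sub h2).sub h3
    have h5 : Ψ = fun w => F w - F y - inner ℝ (gradient F y) (w - y)
        - inner ℝ ((H ∘ fun w : E3 => w - y) w) (w - y) * (1 / 2) := by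
      funext w; simp only [hΨ, Function.comp]; ring
    rw [h5]
    refine h4.congr_fderiv ?_
    ext v
    have h6 := inner_fderiv_gradient_comm hF y v (w - y)
    rw [← hH] at h6
    have h7 := real_inner_comm (H v) (w - y)
    simp [-map_sub, inner_sub_left (𝕜 := ℝ) (E := E3) (gradient F w - _),
      inner_sub_left (gradient F w), inner_gradient_left] at h6 ⊢
    linarith
  obtain ⟨δ, hδ, hball⟩ := Metric.eventually_nhds_iff.1
    (hGd.hasFDerivAt.isLittleO.def hε)
  filter_upwards [ball_mem_nhds y hδ] with z hz
  have hmv := (convex_closedBall y ‖z - y‖).norm_image_sub_le_of_norm_hasFDerivWithin_le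
    (f := Ψ) (C := ε * ‖z - y‖) (fun w _ => (hder w).hasFDerivWithinAt)
    (fun w hw => by
      rw [LinearIsometryEquiv.norm_map]
      have hw' : dist w y ≤ ‖z - y‖ := hw
      have hzd : ‖z - y‖ < δ := by rw [← dist_eq_norm]; exact hz
      refine (hball (hw'.trans_lt hzd)).trans ?_
      rw [← dist_eq_norm w]
      gcongr)
    (mem_closedBall_self (norm_nonneg _)) (show z ∈ closedBall y ‖z - y‖ by
      rw [mem_closedBall, dist_eq_norm])
  have hy0 : Ψ y = 0 := by simp [hΨ]
  rw [hy0, sub_zero, Real.norm_eq_abs] at hmv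
  calc _ ≤ ε * ‖z - y‖ * ‖z - y‖ := hmv
    _ = _ := by ring

end Gradient

/-! ### Principal curvatures and the Hessian -/

section Curvature

/-- The normal curvatures of the level set `{F = 0}` are at most `κ` in absolute value. They are
expressed through the Hessian of `F` on tangent vectors, which makes the condition invariant under
`F ↦ -F`. -/
def NormalCurvatureLE (F : E3 → ℝ) (κ : ℝ) : Prop :=
  ∀ y ∈ zeroSet F, ∀ v : E3, inner ℝ (gradient F y) v = 0 →
    |inner ℝ (fderiv ℝ (gradient F) y v) v| ≤ κ * ‖gradient F y‖ * ‖v‖ ^ 2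

theorem zeroSet_neg (F : E3 → ℝ) : zeroSet (-F) = zeroSet F := by
  ext x; simp [zeroSet]

theorem NormalCurvatureLE.neg {F : E3 → ℝ} {κ : ℝ} (h : NormalCurvatureLE F κ) :
    NormalCurvatureLE (-F) κ := by
  intro y hy v hv
  rw [zeroSet_neg] at hy
  rw [gradient_neg] at hv ⊢
  have := h y hy v (by simpa using hv)
  simpa [fderiv_neg] using this

theorem ImplicitSurface.IsSmoothCompactSurface.neg {F : E3 → ℝ} (h : IsSmoothCompactSurface F) :
    IsSmoothCompactSurface (-F) where
  smooth := h.smooth.neg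
  compact := by rw [zeroSet_neg]; exact h.compact
  nonempty := by rw [zeroSet_neg]; exact h.nonempty
  regular x hx := by
    rw [zeroSet_neg] at hx
    rw [gradient_neg]
    simpa using h.regular x hx

variable {F : E3 → ℝ}

theorem contDiffAt_unitNormal (hF : ContDiff ℝ (⊤ : ℕ∞) F) {x : E3} (hx : gradient F x ≠ 0) :
    ContDiffAt ℝ (⊤ : ℕ∞) (unitNormal F) x := by
  have hG := (contDiff_gradient hF).contDiffAt (x := x)
  exact ((hG.norm ℝ hx).inv (norm_ne_zero_iff.2 hx)).smul hG

theorem inner_shapeOperator (hF : ContDiff ℝ (⊤ : ℕ∞) F) {x : E3} (hx : gradient F x ≠ 0)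
    (v w : tangentPlane F x) : inner ℝ (shapeOperator F x v) w =
      -(‖gradient F x‖⁻¹ * inner ℝ (fderiv ℝ (gradient F) x v) (w : E3)) := by
  have hG : DifferentiableAt ℝ (gradient F) x := (contDiff_gradient hF).differentiable (by simp) x
  have hinv : DifferentiableAt ℝ (fun y => ‖gradient F y‖⁻¹) x :=
    (hG.norm ℝ hx).inv (norm_ne_zero_iff.2 hx)
  have hd : fderiv ℝ (unitNormal F) x = _ := (hinv.hasFDerivAt.smul hG.hasFDerivAt).fderiv
  have hw : inner ℝ (gradient F x) (w : E3) = 0 :=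
    Submodule.mem_orthogonal_singleton_iff_inner_right.1 w.2
  have h1 : shapeOperator F x v =
      -(tangentPlane F x).orthogonalProjectionOnto (fderiv ℝ (unitNormal F) x v) := rfl
  rw [h1, inner_neg_left, Submodule.inner_orthogonalProjectionOnto_eq_of_mem_right, hd]
  simp [inner_add_left, real_inner_smul_left, hw]

theorem isSymmetric_shapeOperator (hF : ContDiff ℝ (⊤ : ℕ∞) F) {x : E3} (hx : gradient F x ≠ 0) :
    (shapeOperator F x).IsSymmetric := by
  intro v w
  rw [inner_shapeOperator hF hx, real_inner_comm (shapeOperator F x w), inner_shapeOperator hF hx,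
    inner_fderiv_gradient_comm hF]

/-- A symmetric operator whose eigenvalues have absolute values summing to at most `κ` has a
quadratic form bounded by `κ`. -/
theorem LinearMap.IsSymmetric.abs_inner_le {V : Type*} [NormedAddCommGroup V]
    [InnerProductSpace ℝ V] [FiniteDimensional ℝ V] {S : V →ₗ[ℝ] V} (hS : S.IsSymmetric) {κ : ℝ}
    (hκ : (S.charpoly.roots.map fun a => |a|).sum ≤ κ) (v : V) :
    |inner ℝ (S v) v| ≤ κ * ‖v‖ ^ 2 := by
  have hev : ∀ i, |hS.eigenvalues rfl i| ≤ κ := by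
    intro i
    refine le_trans ?_ hκ
    refine Multiset.single_le_sum (fun a ha => ?_) _ ?_
    · obtain ⟨b, -, rfl⟩ := Multiset.mem_map.1 ha
      exact abs_nonneg b
    · refine Multiset.mem_map_of_mem _ ?_
      rw [hS.roots_charpoly_eq_eigenvalues rfl]
      simp
  set b := hS.eigenvectorBasis rfl
  rw [← b.sum_inner_mul_inner (S v) v, ← b.sum_sq_norm_inner_right v, Finset.mul_sum]
  refine (Finset.abs_sum_le_sum_abs _ _).trans (Finset.sum_le_sum fun i _ => ?_)
  have h1 : inner ℝ (S v) (b i) = hS.eigenvalues rfl i * inner ℝ (b i) v := by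
    rw [hS, hS.apply_eigenvectorBasis, real_inner_comm]
    simp [real_inner_smul_left, b]
  rw [h1, mul_assoc, abs_mul, ← sq, Real.norm_eq_abs, sq_abs, abs_of_nonneg (sq_nonneg (inner ℝ (b i) v))]
  exact mul_le_mul_of_nonneg_right (hev i) (sq_nonneg _)

theorem abs_le_norm_of_mem_principalCurvatures {x : E3} {κ : ℝ}
    (h : κ ∈ principalCurvatures F x) : |κ| ≤ ‖fderiv ℝ (unitNormal F) x‖ := by
  have hev : Module.End.HasEigenvalue (shapeOperator F x) κ := by
    rw [Module.End.hasEigenvalue_iff_isRoot_charpoly]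
    exact Polynomial.isRoot_of_mem_roots h
  obtain ⟨v, hv⟩ := hev.exists_hasEigenvector
  have hv0 : 0 < ‖v‖ := norm_pos_iff.2 hv.2
  refine le_of_mul_le_mul_right ?_ hv0
  calc |κ| * ‖v‖ = ‖shapeOperator F x v‖ := by
        rw [hv.apply_eq_smul, norm_smul, Real.norm_eq_abs]
    _ = ‖(tangentPlane F x).orthogonalProjectionOnto (fderiv ℝ (unitNormal F) x v)‖ := norm_neg _
    _ ≤ ‖fderiv ℝ (unitNormal F) x v‖ := Submodule.norm_orthogonalProjectionOnto_apply_le _ _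
    _ ≤ ‖fderiv ℝ (unitNormal F) x‖ * ‖v‖ := ContinuousLinearMap.le_opNorm _ _

theorem bddAbove_sum_principalCurvatures (hF : IsSmoothCompactSurface F) :
    BddAbove ((fun x => ((principalCurvatures F x).map fun κ => |κ|).sum) '' zeroSet F) := by
  have hc : ContinuousOn (fun x => ‖fderiv ℝ (unitNormal F) x‖) (zeroSet F) := fun x hx =>
    ((contDiffAt_unitNormal hF.smooth (hF.regular x hx)).fderiv_right (m := 0)
      (by simp)).continuousAt.norm.continuousWithinAt
  obtain ⟨C, hC⟩ := hF.compact.bddAbove_image hc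
  refine ⟨3 * C, ?_⟩
  rintro _ ⟨x, hx, rfl⟩
  have hCx : ‖fderiv ℝ (unitNormal F) x‖ ≤ C := hC ⟨x, hx, rfl⟩
  have h1 : ((principalCurvatures F x).map fun κ => |κ|).sum ≤
      (principalCurvatures F x).card • C := by
    rw [← Multiset.card_map (fun κ => |κ|)]
    refine Multiset.sum_le_card_nsmul _ _ fun a ha => ?_
    obtain ⟨κ, hκ, rfl⟩ := Multiset.mem_map.1 ha
    exact (abs_le_norm_of_mem_principalCurvatures hκ).trans hCx
  have h2 : (principalCurvatures F x).card ≤ 3 := by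
    refine (Polynomial.card_roots' _).trans ?_
    rw [LinearMap.charpoly_natDegree]
    refine (Submodule.finrank_le _).trans ?_
    simp
  have hC0 : 0 ≤ C := (norm_nonneg _).trans hCx
  refine h1.trans ?_
  rw [nsmul_eq_mul]
  exact mul_le_mul_of_nonneg_right (by exact_mod_cast h2) hC0

theorem curvatureBound_nonneg (F : E3 → ℝ) : 0 ≤ curvatureBound F := by
  refine mul_nonneg (by norm_num) (Real.sSup_nonneg ?_)
  rintro _ ⟨x, -, rfl⟩
  refine Multiset.sum_nonneg fun a ha => ?_
  obtain ⟨b, -, rfl⟩ := Multiset.mem_map.1 ha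
  exact abs_nonneg b

theorem normalCurvatureLE_curvatureBound (hF : IsSmoothCompactSurface F) :
    NormalCurvatureLE F (2 * curvatureBound F) := by
  intro y hy v hv
  have hg := hF.regular y hy
  have hg0 : 0 < ‖gradient F y‖ := norm_pos_iff.2 hg
  have hsum : ((principalCurvatures F y).map fun κ => |κ|).sum ≤ 2 * curvatureBound F := by
    rw [curvatureBound, ← mul_assoc]
    norm_num
    exact le_csSup (bddAbove_sum_principalCurvatures hF) ⟨y, hy, rfl⟩
  have h := (isSymmetric_shapeOperator hF.smooth hg).abs_inner_le hsum
    ⟨v, Submodule.mem_orthogonal_singleton_iff_inner_right.2 hv⟩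
  rw [inner_shapeOperator hF.smooth hg, abs_neg, abs_mul, abs_of_nonneg (by positivity),
    inv_mul_le_iff₀ hg0] at h
  refine h.trans_eq ?_
  simp only [Submodule.coe_norm]
  ring

end Curvature

/-! ### Touching balls -/

section Barriers

variable {F : E3 → ℝ}

theorem exists_zero_mem_segment (hF : Continuous F) {a b : E3} (ha : F a ≤ 0) (hb : 0 ≤ F b) :
    ∃ w ∈ segment ℝ a b, F w = 0 :=
  (convex_segment a b).isPreconnected.intermediate_value (left_mem_segment ℝ a b)
    (right_mem_segment ℝ a b) hF.continuousOn ⟨ha, hb⟩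

theorem exists_zero_dist_add_dist (hF : Continuous F) {a b : E3} (ha : F a ≤ 0) (hb : 0 ≤ F b) :
    ∃ w ∈ zeroSet F, dist a w + dist w b = dist a b := by
  obtain ⟨w, hw, hw0⟩ := exists_zero_mem_segment hF ha hb
  exact ⟨w, hw0, dist_add_dist_of_mem_segment hw⟩

theorem eventually_pos_of_inner_gradient_pos (hF : Differentiable ℝ F) {y v : E3} (hy : F y = 0)
    (hv : 0 < inner ℝ (gradient F y) v) : ∀ᶠ t in 𝓝[>] (0 : ℝ), 0 < F (y + t • v) := by
  have hd : HasDerivAt (fun t : ℝ => F (y + t • v)) (inner ℝ (gradient F y) v) 0 := by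
    have h1 : HasDerivAt (fun t : ℝ => y + t • v) v 0 := by
      simpa using ((hasDerivAt_id (0 : ℝ)).smul_const v).const_add y
    have h2 : HasFDerivAt F (fderiv ℝ F y) (y + (0 : ℝ) • v) := by
      simpa using (hF y).hasFDerivAt
    rw [inner_gradient_left]
    exact h2.comp_hasDerivAt 0 h1
  filter_upwards [hd.tendsto_slope_zero_right.eventually_const_lt hv, self_mem_nhdsWithin]
    with t ht (ht0 : 0 < t)
  simp only [zero_add, zero_smul, add_zero, hy, sub_zero, smul_eq_mul] at ht
  exact pos_of_mul_pos_right ht (inv_nonneg.2 ht0.le)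

theorem norm_unitNormal {y : E3} (hy : gradient F y ≠ 0) : ‖unitNormal F y‖ = 1 := by
  rw [unitNormal, norm_smul, norm_inv, norm_norm, inv_mul_cancel₀ (norm_ne_zero_iff.2 hy)]

theorem norm_gradient_smul_unitNormal {y : E3} (hy : gradient F y ≠ 0) :
    ‖gradient F y‖ • unitNormal F y = gradient F y := by
  rw [unitNormal, smul_smul, mul_inv_cancel₀ (norm_ne_zero_iff.2 hy), one_smul]

theorem unitNormal_neg (F : E3 → ℝ) (y : E3) : unitNormal (-F) y = -unitNormal F y := by
  simp [unitNormal, gradient_neg]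

theorem neg_of_dist_lt_infDist (hF : Continuous F) {z w : E3} (hz : F z < 0)
    (hw : dist z w < infDist z (zeroSet F)) : F w < 0 := by
  by_contra! hcon
  obtain ⟨q, hq, hqd⟩ := exists_zero_dist_add_dist hF hz.le hcon
  have := infDist_le_dist_of_mem (x := z) hq
  linarith [dist_nonneg (x := q) (y := w)]

/-- A point where `F < 0` lies on the inner normal through each of its nearest points. -/
theorem eq_sub_smul_unitNormal (hF : Differentiable ℝ F) {y z : E3} (hg : gradient F y ≠ 0)
    (hy : y ∈ zeroSet F) (hyz : dist z y = infDist z (zeroSet F)) (hz : F z < 0) :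
    z = y - infDist z (zeroSet F) • unitNormal F y := by
  have hy0 : F y = 0 := hy
  have hg0 : 0 < ‖gradient F y‖ := norm_pos_iff.2 hg
  set n := unitNormal F y with hn
  have hn1 : ‖n‖ = 1 := norm_unitNormal hg
  set σ := infDist z (zeroSet F) with hσ
  have hw : ‖z - y‖ = σ := by rw [← dist_eq_norm, hyz]
  have hσ0 : 0 < σ := by
    rw [← hw, norm_pos_iff, sub_ne_zero]
    rintro rfl
    exact hz.ne hy0
  have hle : inner ℝ n (z - y) ≤ -σ := by
    by_contra! hcon
    -- the bisector of the outer normal and of the direction to `z` would lead both into the ball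
    -- about `z`, where `F < 0`, and to values `F > 0`
    set v : E3 := (z - y) + σ • n with hv
    have h1 : 0 < inner ℝ (z - y) v := by
      rw [hv, inner_add_right, real_inner_self_eq_norm_sq, real_inner_smul_right, real_inner_comm,
        hw]
      nlinarith
    have h2 : 0 < inner ℝ (gradient F y) v := by
      rw [← norm_gradient_smul_unitNormal hg, ← hn, hv, real_inner_smul_left, inner_add_right,
        real_inner_smul_right, real_inner_self_eq_norm_sq, hn1]
      refine mul_pos hg0 (by linarith)
    have hc : ∀ᶠ t in 𝓝 (0 : ℝ), t * ‖v‖ ^ 2 - 2 * inner ℝ (z - y) v < 0 := by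
      refine (isOpen_lt (by fun_prop) continuous_const).mem_nhds ?_
      simpa using h1
    obtain ⟨t, ⟨ht1, ht2⟩, ht0 : 0 < t⟩ := (((eventually_pos_of_inner_gradient_pos hF hy0 h2).and
      (hc.filter_mono nhdsWithin_le_nhds)).and self_mem_nhdsWithin).exists
    refine lt_asymm ht1 (neg_of_dist_lt_infDist hF.continuous hz ?_)
    rw [← hσ, dist_eq_norm]
    refine lt_of_pow_lt_pow_left₀ 2 hσ0.le ?_
    rw [show z - (y + t • v) = (z - y) - t • v by abel, norm_sub_sq_real, real_inner_smul_right,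
      norm_smul, Real.norm_of_nonneg ht0.le, hw]
    nlinarith
  have h1 : inner ℝ (-n) (z - y) = ‖-n‖ * ‖z - y‖ := by
    refine le_antisymm (real_inner_le_norm _ _) ?_
    rw [norm_neg, hn1, hw, inner_neg_left]
    linarith
  have h2 := inner_eq_norm_mul_iff_real.1 h1
  rw [norm_neg, hn1, hw, one_smul, smul_neg] at h2
  rw [sub_eq_add_neg, h2]
  abel

/-- The quadratic form of `H` at `v` agrees, up to a term that is small when the normal component
of `v` is, with its value at the tangential component. -/
theorem quadratic_form_tangential {V : Type*} [NormedAddCommGroup V] [InnerProductSpace ℝ V]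
    (H : V →L[ℝ] V) {n : V} (hn : ‖n‖ = 1) (v : V) :
    ‖v - inner ℝ n v • n‖ ≤ ‖v‖ ∧
      inner ℝ (H v) v ≤ inner ℝ (H (v - inner ℝ n v • n)) (v - inner ℝ n v • n) +
        2 * (‖H‖ * |inner ℝ n v| * ‖v‖) := by
  set a := inner ℝ n v with ha
  obtain ⟨w, hw⟩ : ∃ w, w = v - a • n := ⟨_, rfl⟩
  have hv : v = w + a • n := by rw [hw]; abel
  have hnw : inner ℝ n w = 0 := by
    rw [hw, inner_sub_right, real_inner_smul_right, real_inner_self_eq_norm_sq, hn, ← ha]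
    ring
  rw [← hw]
  have hle : ‖w‖ ≤ ‖v‖ := by
    refine le_of_sq_le_sq ?_ (norm_nonneg _)
    have h := norm_add_sq_real w (a • n)
    rw [← hv, real_inner_smul_right, real_inner_comm, hnw] at h
    nlinarith [sq_nonneg ‖a • n‖]
  refine ⟨hle, ?_⟩
  have h1 : inner ℝ (H n) w ≤ ‖H‖ * ‖v‖ ∧ -(‖H‖ * ‖v‖) ≤ inner ℝ (H n) w := by
    have h2 : ‖H n‖ ≤ ‖H‖ := by simpa [hn] using H.le_opNorm n
    have h3 : ‖H n‖ * ‖w‖ ≤ ‖H‖ * ‖v‖ := mul_le_mul h2 hle (norm_nonneg _) (norm_nonneg _)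
    have h4 := abs_le.1 ((abs_real_inner_le_norm (H n) w).trans h3)
    exact ⟨h4.2, h4.1⟩
  have h2 : |inner ℝ (H v) n| ≤ ‖H‖ * ‖v‖ := by
    refine (abs_real_inner_le_norm (H v) n).trans ?_
    rw [hn, mul_one]
    exact H.le_opNorm v
  have hsplit : inner ℝ (H v) v = inner ℝ (H w) w + a * (inner ℝ (H n) w + inner ℝ (H v) n) := by
    have h3 : inner ℝ (H v) v = inner ℝ (H v) (w + a • n) := by rw [← hv]
    have h4 : inner ℝ (H v) w = inner ℝ (H (w + a • n)) w := by rw [← hv]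
    rw [h3, inner_add_right, h4, map_add, map_smul, inner_add_left, real_inner_smul_left,
      real_inner_smul_right]
    ring
  have h3 : a * (inner ℝ (H n) w + inner ℝ (H v) n) ≤ |a| * (2 * (‖H‖ * ‖v‖)) := by
    refine (le_abs_self _).trans ?_
    rw [abs_mul]
    refine mul_le_mul_of_nonneg_left ?_ (abs_nonneg a)
    have := abs_add_le (inner ℝ (H n) w) (inner ℝ (H v) n)
    have := abs_le.2 ⟨h1.2, h1.1⟩
    linarith
  rw [hsplit]
  linarith

/-- Where the normal curvatures are at most `κ`, the surface near `y` stays outside the ball of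
any radius `R < 1 / κ` that touches it at `y` from the side `F < 0`. -/
theorem eventually_neg_of_mem_touching_ball (hF : ContDiff ℝ (⊤ : ℕ∞) F) {κ R : ℝ} (hκ0 : 0 ≤ κ)
    (hκ : NormalCurvatureLE F κ) (hR : 0 < R) (hκR : κ * R < 1) {y : E3} (hy : y ∈ zeroSet F)
    (hg : gradient F y ≠ 0) :
    ∀ᶠ z in 𝓝 y, dist z (y - R • unitNormal F y) ≤ R → z ≠ y → F z < 0 := by
  have hy0 : F y = 0 := hy
  set n := unitNormal F y with hn
  have hn1 : ‖n‖ = 1 := norm_unitNormal hg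
  set g := ‖gradient F y‖ with hgdef
  have hg0 : 0 < g := norm_pos_iff.2 hg
  have hgn : gradient F y = g • n := (norm_gradient_smul_unitNormal hg).symm
  set H := fderiv ℝ (gradient F) y with hH
  set C := ‖H‖ with hC
  have hC0 : 0 ≤ C := norm_nonneg _
  set ε := g * (1 - κ * R) / (8 * R) with hε
  have hε0 : 0 < ε := by
    have : 0 < 1 - κ * R := by linarith
    positivity
  have hεR : 8 * R * ε = g * (1 - κ * R) := by rw [hε]; field_simp
  have hlim : ∀ᶠ z in 𝓝 y, C * ‖z - y‖ < min g (2 * R * ε) := by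
    have hc : Continuous fun z : E3 => C * ‖z - y‖ := by fun_prop
    refine (isOpen_lt hc continuous_const).mem_nhds ?_
    have : 0 < min g (2 * R * ε) := lt_min hg0 (by positivity)
    simpa using this
  filter_upwards [eventually_taylor hF y hε0, hlim] with z hz hzC hzR hne
  set v := z - y with hv
  have hv0 : 0 < ‖v‖ := norm_pos_iff.2 (sub_ne_zero.2 hne)
  have hC1 : C * ‖v‖ < g := hzC.trans_le (min_le_left _ _)
  have hC2 : C * ‖v‖ < 2 * R * ε := hzC.trans_le (min_le_right _ _)
  set a := inner ℝ n v with ha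
  have ha2 : 2 * R * a ≤ -‖v‖ ^ 2 := by
    have h1 : ‖v + R • n‖ ^ 2 ≤ R ^ 2 := by
      refine pow_le_pow_left₀ (norm_nonneg _) ?_ 2
      rw [dist_eq_norm] at hzR
      rwa [hv, show z - y + R • n = z - (y - R • n) by abel]
    rw [norm_add_sq_real, real_inner_smul_right, norm_smul, hn1, Real.norm_of_nonneg hR.le,
      real_inner_comm, ← ha] at h1
    nlinarith
  have ha0 : a ≤ 0 := by
    by_contra! h
    nlinarith [sq_nonneg ‖v‖, mul_pos hR h]
  have hvtn : inner ℝ (gradient F y) (v - a • n) = 0 := by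
    rw [hgn, real_inner_smul_left, inner_sub_right, real_inner_smul_right,
      real_inner_self_eq_norm_sq, hn1, ← ha]
    ring
  obtain ⟨hvt, hquad⟩ := quadratic_form_tangential H hn1 v
  rw [← ha] at hvt hquad
  have hc1 := (abs_le.1 (hκ y hy _ hvtn)).2
  rw [← hH, ← hgdef] at hc1
  have hc2 : κ * g * ‖v - a • n‖ ^ 2 ≤ κ * g * ‖v‖ ^ 2 :=
    mul_le_mul_of_nonneg_left (pow_le_pow_left₀ (norm_nonneg _) hvt 2) (by positivity)
  have htay := (abs_le.1 hz).2
  rw [hy0, sub_zero, hgn, real_inner_smul_left, ← ha] at htay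
  rw [abs_of_nonpos ha0, ← hC] at hquad
  have hup : F z ≤ a * (g - C * ‖v‖) + (κ * g / 2 + ε) * ‖v‖ ^ 2 := by linarith
  have hm3 : 2 * R * a * (g - C * ‖v‖) ≤ -‖v‖ ^ 2 * (g - C * ‖v‖) :=
    mul_le_mul_of_nonneg_right ha2 (by linarith)
  have h5 : 2 * R * F z ≤ ‖v‖ ^ 2 * (C * ‖v‖ - g + κ * R * g + 2 * R * ε) := by
    have := mul_le_mul_of_nonneg_left hup (show 0 ≤ 2 * R by positivity)
    linarith
  have h6 : C * ‖v‖ - g + κ * R * g + 2 * R * ε < 0 := by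
    have : 0 < R * ε := mul_pos hR hε0
    linarith
  have hfin : 2 * R * F z < 0 := h5.trans_lt (mul_neg_of_pos_of_neg (by positivity) h6)
  by_contra! hcon
  nlinarith [mul_nonneg hR.le hcon]

end Barriers

/-! ### Position of the vertices relative to the tangent planes -/

section Transversality

variable {F : E3 → ℝ}

/-- The ball of radius `h` touching the surface at `x` from the side `F < 0` contains no point of
the surface: small touching balls are empty by the curvature bound, and uniqueness of nearest
points lets them grow. -/
theorem infDist_inner_normal (hF : IsSmoothCompactSurface F) {κ h : ℝ} (hκ0 : 0 ≤ κ)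
    (hκ : NormalCurvatureLE F κ) (hh : 0 < h) (hu : UniqueNearest (zeroSet F) h) {x : E3}
    (hx : x ∈ zeroSet F) :
    infDist (x - h • unitNormal F x) (zeroSet F) = h ∧ F (x - h • unitNormal F x) < 0 := by
  have hg := hF.regular x hx
  set n := unitNormal F x with hn
  have hn1 : ‖n‖ = 1 := norm_unitNormal hg
  set R := (κ + 1)⁻¹ with hR
  have hR0 : 0 < R := by positivity
  have hκR : κ * R < 1 := by
    rw [hR, ← div_eq_mul_inv, div_lt_one (by linarith)]; linarith
  obtain ⟨δ, hδ, hloc⟩ := Metric.eventually_nhds_iff.1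
    (eventually_neg_of_mem_touching_ball hF.smooth hκ0 hκ hR0 hκR hx hg)
  rw [← hn] at hloc
  set s := min h (min R (δ / 3)) with hs
  have hs0 : 0 < s := lt_min hh (lt_min hR0 (by linarith))
  have hsh : s ≤ h := min_le_left _ _
  have hsR : s ≤ R := (min_le_right _ _).trans (min_le_left _ _)
  have hsδ : s ≤ δ / 3 := (min_le_right _ _).trans (min_le_right _ _)
  have hdist : ∀ a b : ℝ, dist (x - a • n) (x - b • n) = |b - a| := by
    intro a b
    rw [dist_eq_norm, show x - a • n - (x - b • n) = (b - a) • n by module, norm_smul, hn1,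
      mul_one, Real.norm_eq_abs]
  have hdx : ∀ a : ℝ, dist (x - a • n) x = |a| := by
    intro a
    have := hdist a 0
    rwa [zero_smul, sub_zero, zero_sub, abs_neg] at this
  have hFs : F (x - s • n) < 0 := by
    refine hloc ?_ ?_ ?_
    · rw [hdx, abs_of_pos hs0]; linarith
    · rw [hdist, abs_of_nonneg (by linarith)]; linarith
    · rw [← dist_ne_zero, hdx, abs_of_pos hs0]; exact hs0.ne'
  have hstart : infDist (x - s • n) (zeroSet F) = s := by
    refine le_antisymm ?_ ((le_infDist hF.nonempty).2 fun q hq => ?_)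
    · exact (infDist_le_dist_of_mem hx).trans_eq (by rw [hdx, abs_of_pos hs0])
    · by_contra! hcon
      have h1 := hdx s
      rw [abs_of_pos hs0] at h1
      have hqx : q ≠ x := by
        rintro rfl
        linarith
      have h2 := dist_triangle q (x - s • n) x
      have h3 := dist_triangle q (x - s • n) (x - R • n)
      rw [hdist, abs_of_nonneg (by linarith)] at h3
      rw [dist_comm] at hcon
      have := hloc (show dist q x < δ by linarith) (by linarith) hqx
      exact this.ne hq
  have hfull : infDist (x - h • n) (zeroSet F) = h := by
    have := infDist_ray hF.compact hu (e := -n) hx (by rw [norm_neg, hn1]) hs0 hsh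
      (by rw [smul_neg, ← sub_eq_add_neg]; exact hstart)
    rwa [smul_neg, ← sub_eq_add_neg] at this
  refine ⟨hfull, ?_⟩
  by_contra! hcon
  obtain ⟨q, hq, hqd⟩ := exists_zero_dist_add_dist hF.smooth.continuous hFs.le hcon
  have h1 : h ≤ dist (x - h • n) q := by
    have := infDist_le_dist_of_mem (x := x - h • n) hq
    rwa [hfull] at this
  rw [hdist, abs_of_nonneg (by linarith), dist_comm q] at hqd
  linarith [dist_nonneg (x := x - s • n) (y := q)]

/-- The signed distance to the surface `{F = 0}`, with the sign of `F`. -/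
noncomputable def signedSurfaceDist (F : E3 → ℝ) (z : E3) : ℝ :=
  if F z ≤ 0 then -infDist z (zeroSet F) else infDist z (zeroSet F)

theorem signedSurfaceDist_of_nonpos {z : E3} (hz : F z ≤ 0) :
    signedSurfaceDist F z = -infDist z (zeroSet F) := if_pos hz

theorem signedSurfaceDist_of_pos {z : E3} (hz : 0 < F z) :
    signedSurfaceDist F z = infDist z (zeroSet F) := if_neg hz.not_ge

theorem continuous_signedSurfaceDist (hF : Continuous F) : Continuous (signedSurfaceDist F) := by
  refine Continuous.if_le (continuous_infDist_pt _).neg (continuous_infDist_pt _) hF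
    continuous_const fun z hz => ?_
  rw [infDist_zero_of_mem (show z ∈ zeroSet F from hz), neg_zero]

/-- Let `y` be the nearest point to `z`, and let a ball of radius `R < 1 / κ` centred at `c` touch
the surface at `y` from the side `F < 0`. Near `z`, the signed distance increased by `R` is at most
the distance to `c`, with equality at `z` itself. -/
theorem signedSurfaceDist_le_near (hF : IsSmoothCompactSurface F) {κ h R : ℝ} (hκ0 : 0 ≤ κ)
    (hκ : NormalCurvatureLE F κ) (hu : UniqueNearest (zeroSet F) h) (hhR : h ≤ R)
    (hκR : κ * R < 1) {z : E3} (hz : infDist z (zeroSet F) < h) :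
    ∃ y ∈ zeroSet F, z = y + signedSurfaceDist F z • unitNormal F y ∧
      ∀ᶠ z' in 𝓝 z, (signedSurfaceDist F z' + R) ^ 2 ≤ ‖z' - (y - R • unitNormal F y)‖ ^ 2 := by
  have hFc := hF.smooth.continuous
  have hFd : Differentiable ℝ F := hF.smooth.differentiable (by simp)
  have hd0 : 0 ≤ infDist z (zeroSet F) := infDist_nonneg
  have hR0 : 0 < R := by linarith
  obtain ⟨y, ⟨hy, hyz⟩, hyu⟩ := hu z hz
  have hy0 : F y = 0 := hy
  have hg := hF.regular y hy
  have hfoot : z = y + signedSurfaceDist F z • unitNormal F y := by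
    rcases lt_trichotomy (F z) 0 with hs | hs | hs
    · rw [signedSurfaceDist_of_nonpos hs.le, neg_smul, ← sub_eq_add_neg]
      exact eq_sub_smul_unitNormal hFd hg hy hyz hs
    · have h0 : infDist z (zeroSet F) = 0 := infDist_zero_of_mem hs
      rw [h0, dist_eq_zero] at hyz
      rw [signedSurfaceDist_of_nonpos hs.le, h0, hyz]
      simp
    · have := eq_sub_smul_unitNormal (F := -F) hFd.neg (y := y) (z := z)
        (by rw [gradient_neg]; simpa using hg) (by rwa [zeroSet_neg]) (by rwa [zeroSet_neg])
        (by simpa using hs)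
      rwa [unitNormal_neg, zeroSet_neg, smul_neg, sub_neg_eq_add,
        ← signedSurfaceDist_of_pos hs] at this
  refine ⟨y, hy, hfoot, ?_⟩
  set n := unitNormal F y with hn
  have hn1 : ‖n‖ = 1 := norm_unitNormal hg
  set c := y - R • n with hc
  have hφ : |signedSurfaceDist F z| < R := by
    rw [signedSurfaceDist]
    split_ifs
    · rw [abs_neg, abs_of_nonneg hd0]; linarith
    · rw [abs_of_nonneg hd0]; linarith
  have hφ0 : 0 < signedSurfaceDist F z + R := by linarith [(abs_lt.1 hφ).1]
  have hzc : z - c = (signedSurfaceDist F z + R) • n := by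
    nth_rewrite 1 [hfoot]
    rw [hc]; module
  have hzcn : ‖z - c‖ = signedSurfaceDist F z + R := by
    rw [hzc, norm_smul, hn1, mul_one, Real.norm_of_nonneg hφ0.le]
  have hyc : ‖y - c‖ = R := by
    rw [hc, sub_sub_cancel, norm_smul, hn1, mul_one, Real.norm_of_nonneg hR0.le]
  set U : Set E3 := {q | dist q c ≤ R → q ≠ y → F q < 0} with hU
  have hUy : U ∈ 𝓝 y := eventually_neg_of_mem_touching_ball hF.smooth hκ0 hκ hR0 hκR hy hg
  have hE1 := eventually_nearest_mem hF.compact (fun y' h1 h2 => hyu y' ⟨h1, h2⟩) hUy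
  have hE2 : ∀ᶠ z' in 𝓝 z, infDist z' (zeroSet F) < R :=
    (isOpen_lt (continuous_infDist_pt _) continuous_const).mem_nhds (hz.trans_le hhR)
  -- the radial projection of `z'` to the touching sphere tends to `y`
  have hE3 : ∀ᶠ z' in 𝓝 z, c + (R / ‖z' - c‖) • (z' - c) ∈ U := by
    have hca : ContinuousAt (fun z' : E3 => c + (R / ‖z' - c‖) • (z' - c)) z := by
      have : ‖z - c‖ ≠ 0 := by rw [hzcn]; exact hφ0.ne'
      fun_prop (disch := assumption)
    refine hca.preimage_mem_nhds ?_
    have : c + (R / ‖z - c‖) • (z - c) = y := by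
      rw [hzcn, hzc, smul_smul, div_mul_cancel₀ _ hφ0.ne', hc, sub_add_cancel]
    rwa [this]
  have hE4 : ∀ᶠ z' in 𝓝 z, 0 < F z' → R ≤ ‖z' - c‖ := by
    rcases lt_trichotomy (F z) 0 with hs | hs | hs
    · filter_upwards [(isOpen_lt hFc continuous_const).mem_nhds hs] with z' hz' hpos
      exact absurd hpos (not_lt.2 (le_of_lt hz'))
    · have h0 : infDist z (zeroSet F) = 0 := infDist_zero_of_mem hs
      rw [h0, dist_eq_zero] at hyz
      rw [hyz]
      filter_upwards [hUy] with z' hz' hpos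
      by_contra! hlt
      refine lt_asymm hpos (hz' (by rw [dist_eq_norm]; exact hlt.le) ?_)
      rintro rfl
      exact hpos.ne' hy0
    · have hdz : 0 < infDist z (zeroSet F) :=
        (hF.compact.isClosed.notMem_iff_infDist_pos hF.nonempty).1 hs.ne'
      have : R < ‖z - c‖ := by rw [hzcn, signedSurfaceDist_of_pos hs]; linarith
      have hcn : Continuous fun z' : E3 => ‖z' - c‖ := by fun_prop
      filter_upwards [(isOpen_lt continuous_const hcn).mem_nhds this] with z' hz' _
      exact le_of_lt hz'
  filter_upwards [hE1, hE2, hE3, hE4] with z' h1 h2 h3 h4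
  rcases le_or_gt (F z') 0 with hs | hs
  · rw [signedSurfaceDist_of_nonpos hs]
    obtain ⟨q, hq, hqd⟩ := hF.compact.exists_infDist_eq_dist hF.nonempty z'
    have hqR : R ≤ dist q c := by
      by_contra! hlt
      refine (h1 q hq hqd.symm hlt.le ?_).ne hq
      rintro rfl
      rw [dist_eq_norm, hyc] at hlt
      exact hlt.false
    have htri := dist_triangle q z' c
    rw [dist_comm q z', ← hqd, dist_eq_norm z'] at htri
    exact pow_le_pow_left₀ (by linarith) (by linarith) 2
  · rw [signedSurfaceDist_of_pos hs]
    have hRz := h4 hs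
    have hρ : 0 < ‖z' - c‖ := hR0.trans_le hRz
    set w := c + (R / ‖z' - c‖) • (z' - c) with hw
    have hwR : dist w c = R := by
      rw [dist_eq_norm, hw, add_sub_cancel_left, norm_smul, norm_div, norm_norm,
        Real.norm_of_nonneg hR0.le, div_mul_cancel₀ _ hρ.ne']
    have hFw : F w ≤ 0 := by
      by_cases hwy : w = y
      · rw [hwy, hy0]
      · exact (h3 hwR.le hwy).le
    obtain ⟨q, hq, hqd⟩ := exists_zero_dist_add_dist hFc hFw hs.le
    have hwz : dist w z' = ‖z' - c‖ - R := by
      rw [dist_comm, dist_eq_norm, show z' - w = (1 - R / ‖z' - c‖) • (z' - c) by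
        rw [hw]; module, norm_smul, Real.norm_of_nonneg]
      · field_simp
      · rw [sub_nonneg, div_le_one hρ]; exact hRz
    have hle : infDist z' (zeroSet F) ≤ dist q z' := by
      rw [dist_comm]; exact infDist_le_dist_of_mem hq
    have := dist_nonneg (x := w) (y := q)
    have h0 : 0 ≤ infDist z' (zeroSet F) := infDist_nonneg
    exact pow_le_pow_left₀ (by linarith) (by linarith) 2

/-- Let `A` lie on the side `F > 0` of the surface but not above its tangent plane at `x`. The
distance of `A` to the surface is at most the distance to the ball of radius `R` touching at `x`.
Along the segment from `x` to `A`, the function `(φ + R) ^ 2 - |·| ^ 2` of the signed distance `φ`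
has affine local upper supports, hence stays below its supporting line at `x`. -/
theorem infDist_add_sq_le (hF : IsSmoothCompactSurface F) {κ h R : ℝ} (hκ0 : 0 ≤ κ)
    (hκ : NormalCurvatureLE F κ) (hh : 0 < h) (hu : UniqueNearest (zeroSet F) h) (hhR : h ≤ R)
    (hκR : κ * R < 1) {x A : E3} (hx : x ∈ zeroSet F) (hA : 0 < F A) (hxA : ‖A - x‖ ≤ h)
    (hin : inner ℝ (unitNormal F x) (A - x) ≤ 0) :
    (infDist A (zeroSet F) + R) ^ 2 ≤ h ^ 2 + R ^ 2 := by
  set w := A - x with hw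
  set γ : ℝ → E3 := fun t => x + t • w with hγ
  have hγc : Continuous γ := by fun_prop
  set u : ℝ → ℝ := fun t => (signedSurfaceDist F (γ t) + R) ^ 2 - t ^ 2 * ‖w‖ ^ 2 with hu'
  have huc : Continuous u := by
    have := (continuous_signedSurfaceDist hF.smooth.continuous).comp hγc
    have h2 : Continuous fun t => signedSurfaceDist F (γ t) := this
    fun_prop
  have hexp : ∀ (p : E3) (t : ℝ),
      ‖γ t - p‖ ^ 2 = ‖x - p‖ ^ 2 + t * (2 * inner ℝ (x - p) w) + t ^ 2 * ‖w‖ ^ 2 := by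
    intro p t
    rw [hγ, show x + t • w - p = (x - p) + t • w by abel, norm_add_sq_real, real_inner_smul_right,
      norm_smul, mul_pow, Real.norm_eq_abs, sq_abs]
    ring
  have hdγ : ∀ t, 0 ≤ t → t < 1 → infDist (γ t) (zeroSet F) < h := by
    intro t ht0 ht1
    have h1 : infDist (γ t) (zeroSet F) ≤ dist (γ t) x := infDist_le_dist_of_mem hx
    rw [dist_eq_norm, hγ, add_sub_cancel_left, norm_smul, Real.norm_of_nonneg ht0] at h1
    have h2 : t * ‖w‖ ≤ t * h := mul_le_mul_of_nonneg_left hxA ht0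
    have h3 : t * h < 1 * h := mul_lt_mul_of_pos_right ht1 hh
    linarith
  have hsupp : ∀ t, 0 ≤ t → t < 1 → ∃ y ∈ zeroSet F,
      γ t = y + signedSurfaceDist F (γ t) • unitNormal F y ∧
      ∀ᶠ s in 𝓝 t, u s ≤ u t + 2 * inner ℝ (x - (y - R • unitNormal F y)) w * (s - t) := by
    intro t ht0 ht1
    obtain ⟨y, hy, hfoot, hev⟩ := signedSurfaceDist_le_near hF hκ0 hκ hu hhR hκR (hdγ t ht0 ht1)
    refine ⟨y, hy, hfoot, ?_⟩
    have hut : (signedSurfaceDist F (γ t) + R) ^ 2 = ‖γ t - (y - R • unitNormal F y)‖ ^ 2 := by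
      have : γ t - (y - R • unitNormal F y) = (signedSurfaceDist F (γ t) + R) • unitNormal F y := by
        nth_rewrite 1 [hfoot]; module
      rw [this, norm_smul, norm_unitNormal (hF.regular y hy), mul_one, Real.norm_eq_abs, sq_abs]
    filter_upwards [hγc.continuousAt.eventually hev] with s hs
    rw [hexp] at hs hut
    simp only [hu']
    linarith
  have hφx : signedSurfaceDist F (γ 0) = 0 := by
    have : γ 0 = x := by simp [hγ]
    rw [this, signedSurfaceDist_of_nonpos (le_of_eq hx), infDist_zero_of_mem hx, neg_zero]
  obtain ⟨y, hy, hyx, hy0⟩ := hsupp 0 le_rfl one_pos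
  have hxy : x = y := by
    rw [hφx, zero_smul, add_zero] at hyx
    simpa [hγ] using hyx
  subst hxy
  have hmain := le_affine_of_local_support huc.continuousOn
    (fun t ht => by
      obtain ⟨y, -, -, hev⟩ := hsupp t ht.1.le ht.2
      exact ⟨_, hev⟩)
    ((hy0.filter_mono nhdsWithin_le_nhds).mono fun s hs => by simpa using hs)
  have hγ1 : γ 1 = A := by simp [hγ, hw]
  simp only [hu', hφx, hγ1, signedSurfaceDist_of_pos hA, real_inner_smul_left] at hmain
  have h1 : ‖w‖ ^ 2 ≤ h ^ 2 := pow_le_pow_left₀ (norm_nonneg _) hxA 2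
  have h2 : R * inner ℝ (unitNormal F x) w ≤ 0 := mul_nonpos_of_nonneg_of_nonpos (by linarith) hin
  linarith

/-- A point on the side `F > 0` whose distance to the surface exceeds `κ h² / 2` lies strictly above
the tangent plane at every point of the surface that is at distance at most `h` from it. -/
theorem inner_gradient_pos (hF : IsSmoothCompactSurface F) {κ h : ℝ} (hκ0 : 0 ≤ κ)
    (hκ : NormalCurvatureLE F κ) (hu : UniqueNearest (zeroSet F) h) {x A : E3}
    (hx : x ∈ zeroSet F) (hA : 0 < F A) (hxA : dist A x ≤ h)
    (hd : κ * h ^ 2 / 2 < infDist A (zeroSet F)) : 0 < inner ℝ (gradient F x) (A - x) := by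
  by_contra! hcon
  have hg := hF.regular x hx
  have hin : inner ℝ (unitNormal F x) (A - x) ≤ 0 := by
    rw [unitNormal, real_inner_smul_left]
    exact mul_nonpos_of_nonneg_of_nonpos (by positivity) hcon
  have hd0 : 0 < infDist A (zeroSet F) := lt_of_le_of_lt (by positivity) hd
  have hh : 0 < h := hd0.trans_le ((infDist_le_dist_of_mem hx).trans hxA)
  rw [dist_eq_norm] at hxA
  set d := infDist A (zeroSet F) with hddef
  rcases lt_or_ge (κ * h) 1 with hκh | hκh
  · -- a radius between `h` and `1 / κ` that contradicts the lower bound for the distance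
    obtain ⟨R, hhR, hκR, hRd⟩ : ∃ R, h ≤ R ∧ κ * R < 1 ∧ h ^ 2 < 2 * R * d := by
      rcases hκ0.eq_or_lt with rfl | hκpos
      · refine ⟨h + h ^ 2 / d, le_add_of_nonneg_right (by positivity), by simp, ?_⟩
        have : 2 * (h + h ^ 2 / d) * d = 2 * h * d + 2 * h ^ 2 := by field_simp
        rw [this]
        nlinarith [mul_pos hh hd0, sq_nonneg h]
      · have h1 : h ^ 2 / (2 * d) < 1 / κ := by
          rw [div_lt_div_iff₀ (by positivity) hκpos]; linarith
        obtain ⟨r, hr1, hr2⟩ := exists_between h1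
        rw [div_lt_iff₀ (by positivity)] at hr1
        rw [lt_div_iff₀ hκpos] at hr2
        refine ⟨max h r, le_max_left _ _, ?_, ?_⟩
        · rcases max_cases h r with ⟨h2, -⟩ | ⟨h2, -⟩ <;> rw [h2] <;> linarith
        · have := mul_le_mul_of_nonneg_right (le_max_right h r) hd0.le
          linarith
    have := infDist_add_sq_le hF hκ0 hκ hh hu hhR hκR hx hA hxA hin
    nlinarith
  · obtain ⟨hdc, hFc⟩ := infDist_inner_normal hF hκ0 hκ hh hu hx
    set c := x - h • unitNormal F x with hc
    obtain ⟨q, hq, hqd⟩ := exists_zero_dist_add_dist hF.smooth.continuous hFc.le hA.le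
    have h1 : h ≤ dist c q := by rw [← hdc]; exact infDist_le_dist_of_mem hq
    have h2 : d ≤ dist q A := by rw [dist_comm]; exact infDist_le_dist_of_mem hq
    have h3 : dist c A ^ 2 ≤ 2 * h ^ 2 := by
      rw [dist_comm, dist_eq_norm, show A - c = (A - x) + h • unitNormal F x by rw [hc]; abel,
        norm_add_sq_real, real_inner_smul_right, norm_smul, norm_unitNormal hg, mul_one,
        Real.norm_of_nonneg hh.le, real_inner_comm]
      nlinarith [norm_nonneg (A - x), mul_nonpos_of_nonneg_of_nonpos hh.le hin]
    have h4 : (h + d) ^ 2 ≤ dist c A ^ 2 := pow_le_pow_left₀ (by positivity) (by linarith) 2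
    have h5 : h * 1 ≤ h * (κ * h) := mul_le_mul_of_nonneg_left hκh hh.le
    nlinarith [mul_pos hh hd0]

end Transversality

/-! ### Segments crossing the surface -/

section Crossing

variable {F : E3 → ℝ}

/-- At every zero of `F` in `S`, the point `a` lies strictly above the tangent plane, on the side
of increasing `F`. Thus `F` decreases strictly through each of its zeros in `S` when moving away
from `a`. For a point on the side `F < 0` the condition is used with `-F` in place of `F`. -/
def CrossedFrom (F : E3 → ℝ) (S : Set E3) (a : E3) : Prop :=
  ∀ x ∈ S, F x = 0 → 0 < inner ℝ (gradient F x) (a - x)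

theorem CrossedFrom.mono {S S' : Set E3} {a : E3} (h : CrossedFrom F S a) (hS : S' ⊆ S) :
    CrossedFrom F S' a := fun x hx => h x (hS hx)

theorem CrossedFrom.of_mem_convexHull {S V : Set E3} (h : ∀ v ∈ V, CrossedFrom F S v) {w : E3}
    (hw : w ∈ convexHull ℝ V) : CrossedFrom F S w := by
  intro x hx hx0
  have hconv : Convex ℝ {v : E3 | inner ℝ (gradient F x) x < inner ℝ (gradient F x) v} :=
    (convex_Ioi (inner ℝ (gradient F x) x)).linear_preimage
      (innerₛₗ ℝ (gradient F x))
  have := convexHull_min (fun v hv => by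
    have := h v hv x hx hx0
    rw [inner_sub_right] at this
    exact sub_pos.1 this) hconv hw
  rw [inner_sub_right]
  exact sub_pos.2 this

/-- A segment from `a` that has left the side `F > 0` does not return. -/
theorem CrossedFrom.neg_of_mem_segment (hF : Differentiable ℝ F) {a p q : E3}
    (h : CrossedFrom F (segment ℝ a q) a) (hp : p ∈ segment ℝ a q) (hp0 : F p = 0)
    (hpq : p ≠ q) : F q < 0 := by
  set γ : ℝ → E3 := fun t => a + t • (q - a) with hγ
  have hγc : Continuous γ := by fun_prop
  have hγs : ∀ t ∈ Icc (0 : ℝ) 1, γ t ∈ segment ℝ a q := fun t ht => by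
    rw [segment_eq_image']; exact ⟨t, ht, rfl⟩
  have hγ1 : γ 1 = q := by simp [hγ]
  obtain ⟨t₀, ht₀, hγt₀⟩ : ∃ t ∈ Icc (0 : ℝ) 1, γ t = p := by
    rw [segment_eq_image'] at hp; exact hp
  have ht₀1 : t₀ < 1 := by
    refine lt_of_le_of_ne ht₀.2 ?_
    rintro rfl
    exact hpq (hγt₀.symm.trans hγ1)
  have hder : ∀ t ∈ Icc (0 : ℝ) 1, F (γ t) = 0 → 0 < inner ℝ (gradient F (γ t)) (a - q) := by
    intro t ht h0
    have h1 := h _ (hγs t ht) h0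
    rw [hγ, show a - (a + t • (q - a)) = t • (a - q) by module, real_inner_smul_right] at h1
    exact pos_of_mul_pos_right h1 ht.1
  -- just before a zero `F` is positive, just after it negative
  have hbefore : ∀ t ∈ Icc (0 : ℝ) 1, F (γ t) = 0 → ∀ᶠ s in 𝓝[>] (0 : ℝ), 0 < F (γ (t - s)) := by
    intro t ht h0
    filter_upwards [eventually_pos_of_inner_gradient_pos hF h0 (hder t ht h0)] with s hs
    rwa [show γ (t - s) = γ t + s • (a - q) by simp only [hγ]; module]
  have hafter : ∀ t ∈ Icc (0 : ℝ) 1, F (γ t) = 0 → ∀ᶠ s in 𝓝[>] (0 : ℝ), F (γ (t + s)) < 0 := by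
    intro t ht h0
    have h1 : 0 < inner ℝ (gradient (-F) (γ t)) (q - a) := by
      have := hder t ht h0
      rw [gradient_neg, Pi.neg_apply, inner_neg_left, ← inner_neg_right, neg_sub]
      exact this
    filter_upwards [eventually_pos_of_inner_gradient_pos (F := -F) hF.neg (by simpa using h0) h1]
      with s hs
    rw [show γ (t + s) = γ t + s • (q - a) by simp only [hγ]; module]
    simpa using hs
  by_contra! hcon
  obtain ⟨s, hs, hs0, hs1⟩ := ((hafter t₀ ht₀ (by rw [hγt₀, hp0])).and
    (Ioo_mem_nhdsGT (sub_pos.2 ht₀1))).exists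
  have hSc : IsCompact {t | t ∈ Icc (t₀ + s) 1 ∧ 0 ≤ F (γ t)} :=
    isCompact_Icc.inter_right (isClosed_le continuous_const (hF.continuous.comp hγc))
  obtain ⟨m, ⟨hm, hm0⟩, hleast⟩ := hSc.exists_isLeast
    ⟨1, ⟨by linarith, le_rfl⟩, by rwa [hγ1]⟩
  have hlt : t₀ + s < m := by
    refine lt_of_le_of_ne hm.1 ?_
    rintro rfl
    exact absurd hm0 (not_le.2 hs)
  have hneg : ∀ t, t₀ + s ≤ t → t < m → F (γ t) < 0 := by
    intro t h1 h2
    by_contra! h3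
    exact absurd (hleast ⟨⟨h1, h2.le.trans hm.2⟩, h3⟩) (not_le.2 h2)
  have hFm : F (γ m) = 0 := by
    refine le_antisymm ?_ hm0
    have hc : Continuous fun t => F (γ t) := hF.continuous.comp hγc
    refine le_of_tendsto (hc.continuousAt.mono_left (nhdsWithin_le_nhds (s := Iio m))) ?_
    filter_upwards [Ioo_mem_nhdsLT hlt] with t ht
    exact (hneg t ht.1.le ht.2).le
  obtain ⟨r, hr, hr0, hr1⟩ := ((hbefore m ⟨by linarith [ht₀.1], hm.2⟩ hFm).and
    (Ioo_mem_nhdsGT (sub_pos.2 hlt))).exists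
  exact lt_asymm hr (hneg (m - r) (by linarith) (by linarith))

theorem CrossedFrom.eq_of_zero (hF : Differentiable ℝ F) {a b x x' : E3}
    (h : CrossedFrom F (segment ℝ a b) a) (hx : x ∈ segment ℝ a b) (hx0 : F x = 0)
    (hx' : x' ∈ segment ℝ a b) (hx0' : F x' = 0) : x = x' := by
  have key : ∀ y ∈ segment ℝ a b, ∀ z ∈ segment ℝ a b, F z = 0 → F y = 0 → y ∈ segment ℝ a z →
      y = z := by
    intro y _ z hz hz0 hy0 hyz
    by_contra hne
    have hsub : segment ℝ a z ⊆ segment ℝ a b :=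
      (convex_segment a b).segment_subset (left_mem_segment ℝ a b) hz
    exact ((h.mono hsub).neg_of_mem_segment hF hyz hy0 hne).ne hz0
  obtain ⟨t, ht, rfl⟩ := (segment_eq_image' ℝ a b ▸ hx : x ∈ (fun t : ℝ => a + t • (b - a)) '' _)
  obtain ⟨s, hs, rfl⟩ := (segment_eq_image' ℝ a b ▸ hx' : x' ∈ (fun t : ℝ => a + t • (b - a)) '' _)
  have hmem : ∀ t s : ℝ, 0 ≤ t → t ≤ s → a + t • (b - a) ∈ segment ℝ a (a + s • (b - a)) := by
    intro t s ht hts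
    rcases (ht.trans hts).eq_or_lt with rfl | hs
    · rw [le_antisymm hts ht]; simp
    · rw [segment_eq_image']
      refine ⟨t / s, ⟨by positivity, (div_le_one hs).2 hts⟩, ?_⟩
      simp only [add_sub_cancel_left, smul_smul]
      rw [div_mul_cancel₀ _ hs.ne']
  rcases le_total t s with hts | hts
  · exact key _ hx _ hx' hx0' hx0 (hmem t s ht.1 hts)
  · exact (key _ hx' _ hx hx0 hx0' (hmem s t hs.1 hts)).symm

theorem CrossedFrom.pos_of_mem_segment (hF : Differentiable ℝ F) {a b w : E3}
    (h : CrossedFrom F (segment ℝ a b) a) (ha : 0 < F a) (hb : 0 ≤ F b)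
    (hw : w ∈ segment ℝ a b) (hwb : w ≠ b) : 0 < F w := by
  by_contra! hcon
  obtain ⟨p, hp, hp0⟩ := exists_zero_mem_segment hF.continuous hcon ha.le
  rw [segment_symm] at hp
  have hsub : segment ℝ a w ⊆ segment ℝ a b :=
    (convex_segment a b).segment_subset (left_mem_segment ℝ a b) hw
  refine absurd (h.neg_of_mem_segment hF (hsub hp) hp0 ?_) (not_lt.2 hb)
  rintro rfl
  have h1 := dist_add_dist_of_mem_segment hw
  have h2 := dist_add_dist_of_mem_segment hp
  rw [dist_comm p w] at h2
  exact hwb (dist_le_zero.1 (by linarith))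

theorem CrossedFrom.meetsOnce (hF : Differentiable ℝ F) {a b : E3}
    (h : CrossedFrom F (segment ℝ a b) a) (ha : 0 < F a) (hb : F b ≤ 0) :
    MeetsOnce (segment ℝ a b) (zeroSet F) := by
  obtain ⟨p, hp, hp0⟩ := exists_zero_mem_segment hF.continuous hb ha.le
  rw [segment_symm] at hp
  exact ⟨p, ⟨hp, hp0⟩, fun q hq => h.eq_of_zero hF hq.1 hq.2 hp hp0⟩

/-- A broken line `a P b` along which `F` changes from positive to negative, and which is crossed
in the right direction on both of its segments, meets the zero set once. -/
theorem meetsOnce_broken_line (hF : Differentiable ℝ F) {a b P : E3}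
    (h1 : CrossedFrom F (segment ℝ a P) a) (h2 : CrossedFrom (-F) (segment ℝ b P) b)
    (ha : 0 < F a) (hb : F b < 0) :
    MeetsOnce (segment ℝ a P ∪ segment ℝ P b) (zeroSet F) := by
  have key : ∀ {G : E3 → ℝ} {c d : E3}, Differentiable ℝ G → CrossedFrom G (segment ℝ c P) c →
      CrossedFrom (-G) (segment ℝ d P) d → 0 < G c → G d < 0 → G P ≤ 0 →
      MeetsOnce (segment ℝ c P ∪ segment ℝ d P) (zeroSet G) := by
    intro G c d hG h3 h4 hc hd hP
    obtain ⟨p, ⟨hp, hp0⟩, hpu⟩ := h3.meetsOnce hG hc hP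
    refine ⟨p, ⟨Or.inl hp, hp0⟩, ?_⟩
    rintro q ⟨hq | hq, hq0⟩
    · exact hpu q ⟨hq, hq0⟩
    · have hqP : q = P := by
        by_contra hne
        have := h4.pos_of_mem_segment hG.neg (by simpa using hd) (by simpa using hP) hq hne
        rw [Pi.neg_apply, show G q = 0 from hq0, neg_zero] at this
        exact this.false
      subst hqP
      exact hpu q ⟨right_mem_segment ℝ c q, hq0⟩
  rw [segment_symm ℝ P b]
  rcases le_total (F P) 0 with hP | hP
  · exact key hF h1 h2 ha hb hP
  · have := key hF.neg h2 (by rwa [neg_neg]) (by simpa using hb) (by simpa using ha)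
      (by simpa using hP)
    rwa [zeroSet_neg, union_comm] at this

theorem pos_of_mem_convexHull (hF : Continuous F) {S V : Set E3} (hVS : convexHull ℝ V ⊆ S)
    (hpos : ∀ v ∈ V, 0 < F v) (h : ∀ v ∈ V, CrossedFrom F S v) {w : E3}
    (hw : w ∈ convexHull ℝ V) : 0 < F w := by
  by_contra! hcon
  obtain ⟨v, hv⟩ := convexHull_nonempty_iff.1 ⟨w, hw⟩
  obtain ⟨x, hx, hx0⟩ := exists_zero_mem_segment hF hcon (hpos v hv).le
  have hxV : x ∈ convexHull ℝ V :=
    (convex_convexHull ℝ V).segment_subset hw (subset_convexHull ℝ V hv) hx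
  -- a zero in the hull would lie strictly above its own tangent plane
  have := CrossedFrom.of_mem_convexHull h hxV x (hVS hxV) hx0
  simp at this

/-- A zero `B` of `F` may be added to a set of positive vertices: a segment from the hull of these
vertices to `B` cannot meet the zero set before `B`, since it would then arrive with `F < 0`. -/
theorem nonneg_of_mem_convexHull_insert (hF : Differentiable ℝ F) {S V : Set E3} (hS : Convex ℝ S)
    (hVS : V ⊆ S) (hpos : ∀ v ∈ V, 0 < F v) (h : ∀ v ∈ V, CrossedFrom F S v) {B : E3} (hBS : B ∈ S)
    (hB : F B = 0) (hV : V.Nonempty) {P : E3} (hP : P ∈ convexHull ℝ (insert B V)) : 0 ≤ F P := by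
  rw [convexHull_insert hV, mem_convexJoin] at hP
  obtain ⟨b, hb, Q, hQ, hPQ⟩ := hP
  obtain rfl : b = B := hb
  have hVS' : convexHull ℝ V ⊆ S := convexHull_min hVS hS
  rw [segment_symm] at hPQ
  by_cases hPB : P = b
  · rw [hPB, hB]
  refine (((CrossedFrom.of_mem_convexHull h hQ).mono ?_).pos_of_mem_segment hF
    (pos_of_mem_convexHull hF.continuous hVS' hpos h hQ) hB.ge hPQ hPB).le
  exact hS.segment_subset (hVS' hQ) hBS

/-- The case of one positive vertex `a` opposite a face with negative vertices. -/
theorem meetsOnce_of_one_side (hF : Differentiable ℝ F) {S V : Set E3} (hS : Convex ℝ S) {a : E3}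
    (haS : a ∈ S) (hVS : V ⊆ S) (ha : 0 < F a) (hV : ∀ v ∈ V, F v < 0) (hac : CrossedFrom F S a)
    (hVc : ∀ v ∈ V, CrossedFrom (-F) S v) {P : E3} (hP : P ∈ convexHull ℝ V) :
    MeetsOnce (segment ℝ a P) (zeroSet F) := by
  have hVS' : convexHull ℝ V ⊆ S := convexHull_min hVS hS
  refine (hac.mono (hS.segment_subset haS (hVS' hP))).meetsOnce hF ha ?_
  have := pos_of_mem_convexHull (F := -F) hF.neg.continuous hVS'
    (fun v hv => by simpa using hV v hv) hVc hP
  simpa using le_of_lt this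

/-- The case of two positive vertices `a₀`, `a₁` and two negative vertices `a₂`, `a₃`. -/
theorem exists_crossing_of_two_sides (hF : Differentiable ℝ F) {S : Set E3} (hS : Convex ℝ S)
    {a₀ a₁ a₂ a₃ : E3} (h₀ : a₀ ∈ S) (h₁ : a₁ ∈ S) (h₂ : a₂ ∈ S) (h₃ : a₃ ∈ S)
    (hF₀ : 0 < F a₀) (hF₁ : 0 < F a₁) (hF₂ : F a₂ < 0) (hF₃ : F a₃ < 0)
    (hc₀ : CrossedFrom F S a₀) (hc₁ : CrossedFrom F S a₁)
    (hc₂ : CrossedFrom (-F) S a₂) (hc₃ : CrossedFrom (-F) S a₃) :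
    ∃ B : E3, segment ℝ a₀ a₂ ∩ zeroSet F = {B} ∧
      (∀ P ∈ convexHull ℝ {B, a₁, a₃},
        MeetsOnce (segment ℝ a₀ P ∪ segment ℝ P a₂) (zeroSet F)) ∧
      (∀ P ∈ convexHull ℝ {a₀, a₁, B}, MeetsOnce (segment ℝ a₃ P) (zeroSet F)) ∧
      ∀ P ∈ convexHull ℝ {B, a₂, a₃}, MeetsOnce (segment ℝ a₁ P) (zeroSet F) := by
  obtain ⟨B, ⟨hB, hB0⟩, hBu⟩ :=
    (hc₀.mono (hS.segment_subset h₀ h₂)).meetsOnce hF hF₀ hF₂.le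
  have hBS : B ∈ S := hS.segment_subset h₀ h₂ hB
  have hB0' : F B = 0 := hB0
  have hpair : ∀ {u v : E3}, u ∈ S → v ∈ S → ({u, v} : Set E3) ⊆ S := fun hu hv =>
    insert_subset_iff.2 ⟨hu, singleton_subset_iff.2 hv⟩
  have hhull : ∀ {u v P : E3}, u ∈ S → v ∈ S → P ∈ convexHull ℝ {B, u, v} → P ∈ S :=
    fun hu hv hP => convexHull_min (insert_subset_iff.2 ⟨hBS, hpair hu hv⟩) hS hP
  refine ⟨B, eq_singleton_iff_unique_mem.2 ⟨⟨hB, hB0⟩, fun x hx => hBu x hx⟩, ?_, ?_, ?_⟩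
  · intro P hP
    have hPS := hhull h₁ h₃ hP
    exact meetsOnce_broken_line hF (hc₀.mono (hS.segment_subset h₀ hPS))
      (hc₂.mono (hS.segment_subset h₂ hPS)) hF₀ hF₂
  · intro P hP
    rw [show ({a₀, a₁, B} : Set E3) = {B, a₀, a₁} by
      ext x; simp only [mem_insert_iff, mem_singleton_iff]; tauto] at hP
    have hPS := hhull h₀ h₁ hP
    have hFP : 0 ≤ F P := nonneg_of_mem_convexHull_insert hF hS (hpair h₀ h₁)
      (by simp [hF₀, hF₁]) (by simp [hc₀, hc₁]) hBS hB0' (insert_nonempty _ _) hP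
    have := (hc₃.mono (hS.segment_subset h₃ hPS)).meetsOnce hF.neg (by simpa using hF₃)
      (by simpa using hFP)
    rwa [zeroSet_neg] at this
  · intro P hP
    have hPS := hhull h₂ h₃ hP
    have hFP : 0 ≤ (-F) P := nonneg_of_mem_convexHull_insert hF.neg hS (hpair h₂ h₃)
      (by simp [hF₂, hF₃]) (by simp [hc₂, hc₃]) hBS (by simpa using hB0') (insert_nonempty _ _) hP
    exact (hc₁.mono (hS.segment_subset h₁ hPS)).meetsOnce hF hF₁ (by simpa using hFP)

end Crossing

/-! ### Consistent meshes -/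

section Mesh

theorem uniqueNearest_of_le_reach {M : Set E3} (hM : M.Nonempty) {h : ℝ}
    (hr : ENNReal.ofReal h ≤ reach M) : UniqueNearest M h := by
  intro x hx
  have hx' : Metric.infEDist x M < reach M := by
    refine lt_of_lt_of_le ?_ hr
    rw [← ENNReal.ofReal_toReal (infEDist_ne_top hM)]
    exact (ENNReal.ofReal_lt_ofReal_iff_of_nonneg infDist_nonneg).2 hx
  obtain ⟨r, hr, hxr⟩ := lt_sSup_iff.1 hx'
  obtain ⟨y, ⟨hy, hxy⟩, hyu⟩ := hr x hxr.le
  refine ⟨y, ⟨hy, by rw [dist_edist, hxy]; rfl⟩, fun z hz => hyu z ⟨hz.1, ?_⟩⟩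
  rw [← ENNReal.ofReal_toReal (infEDist_ne_top hM), edist_dist, hz.2]
  rfl

theorem dist_le_meshSize {N : ℕ} (T : TetMesh N) (i : Fin N) {p q : E3} (hp : p ∈ body (T i))
    (hq : q ∈ body (T i)) : dist p q ≤ meshSize T := by
  have hb : Bornology.IsBounded (body (T i)) :=
    isBounded_convexHull.2 (finite_range _).isBounded
  exact (dist_le_diam_of_mem hb hp hq).trans
    (le_ciSup (f := fun j => diam (body (T j))) (finite_range _).bddAbove i)

theorem point_mem_body (t : Affine.Simplex ℝ E3 3) (j : Fin 4) : t.points j ∈ body t :=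
  subset_convexHull ℝ _ (mem_range_self j)

theorem meshSize_pos {N : ℕ} (T : TetMesh N) (i : Fin N) : 0 < meshSize T := by
  have hne : (T i).points 0 ≠ (T i).points 1 := (T i).independent.injective.ne (by decide)
  exact (dist_pos.2 hne).trans_le
    (dist_le_meshSize T i (point_mem_body _ _) (point_mem_body _ _))

variable {F : E3 → ℝ} {N : ℕ} {T : TetMesh N} {η : ℝ}

theorem lt_infDist_vertex (hT : IsConsistent η T (zeroSet F))
    (hη : curvatureBound F * meshSize T < η) (i : Fin N) (j : Fin 4) :
    2 * curvatureBound F * meshSize T ^ 2 / 2 < infDist ((T i).points j) (zeroSet F) := by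
  refine lt_of_lt_of_le ?_ (hT.2 i j)
  have := mul_lt_mul_of_pos_right hη (meshSize_pos T i)
  linarith

theorem vertex_ne_zero (hF : IsSmoothCompactSurface F) (hT : IsConsistent η T (zeroSet F))
    (hη : curvatureBound F * meshSize T < η) (i : Fin N) (j : Fin 4) :
    F ((T i).points j) ≠ 0 := by
  refine (hF.compact.isClosed.notMem_iff_infDist_pos hF.nonempty).2 ?_
  refine lt_of_le_of_lt ?_ (lt_infDist_vertex hT hη i j)
  have := curvatureBound_nonneg F
  positivity

theorem crossedFrom_vertex (hF : IsSmoothCompactSurface F) (hT : IsConsistent η T (zeroSet F))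
    (hη : curvatureBound F * meshSize T < η) (i : Fin N) (j : Fin 4)
    (hj : 0 < F ((T i).points j)) : CrossedFrom F (body (T i)) ((T i).points j) := by
  intro x hx hx0
  exact inner_gradient_pos hF (mul_nonneg two_pos.le (curvatureBound_nonneg F))
    (normalCurvatureLE_curvatureBound hF) (uniqueNearest_of_le_reach hF.nonempty hT.1) hx0 hj
    (dist_le_meshSize T i (point_mem_body _ _) hx) (lt_infDist_vertex hT hη i j)

theorem crossedFrom_neg_vertex (hF : IsSmoothCompactSurface F) (hT : IsConsistent η T (zeroSet F))
    (hη : curvatureBound F * meshSize T < η) (i : Fin N) (j : Fin 4)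
    (hj : F ((T i).points j) < 0) : CrossedFrom (-F) (body (T i)) ((T i).points j) := by
  intro x hx hx0
  refine inner_gradient_pos hF.neg (mul_nonneg two_pos.le (curvatureBound_nonneg F))
    (normalCurvatureLE_curvatureBound hF).neg ?_ hx0 (by simpa using hj)
    (dist_le_meshSize T i (point_mem_body _ _) hx) ?_
  · rw [zeroSet_neg]; exact uniqueNearest_of_le_reach hF.nonempty hT.1
  · rw [zeroSet_neg]; exact lt_infDist_vertex hT hη i j

/-- Up to a permutation, four signs are all equal, or split as one against three, or as two
against two. -/
theorem exists_perm_sign_pattern (b : Fin 4 → Bool) : ∃ σ : Equiv.Perm (Fin 4),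
    b (σ 1) = b (σ 0) ∧ b (σ 2) = b (σ 0) ∧ b (σ 3) = b (σ 0) ∨
    b (σ 1) = !b (σ 0) ∧ b (σ 2) = !b (σ 0) ∧ b (σ 3) = !b (σ 0) ∨
    b (σ 1) = b (σ 0) ∧ b (σ 2) = !b (σ 0) ∧ b (σ 3) = !b (σ 0) := by
  revert b
  decide

theorem exists_labelling (F : E3 → ℝ) (A : Fin 4 → E3) (hA : ∀ j, F (A j) ≠ 0) :
    ∃ σ : Equiv.Perm (Fin 4), AllSame F (fun j => A (σ j)) ∨ OneThree F (fun j => A (σ j)) ∨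
      TwoTwo F (fun j => A (σ j)) := by
  obtain ⟨σ, hσ⟩ := exists_perm_sign_pattern fun j => decide (0 < F (A j))
  have hneg : ∀ j, ¬ 0 < F (A j) ↔ F (A j) < 0 := fun j => not_lt.trans (hA j).le_iff_lt
  refine ⟨σ, ?_⟩
  have hall : ∀ p : Fin 4 → Prop, (∀ j, p j) ↔ p 0 ∧ p 1 ∧ p 2 ∧ p 3 := fun p => by
    simp [Fin.forall_fin_succ]
  simp only [← decide_not, decide_eq_decide] at hσ
  simp only [AllSame, OneThree, TwoTwo, ← hneg, hall]
  rcases hσ with ⟨h1, h2, h3⟩ | ⟨h1, h2, h3⟩ | ⟨h1, h2, h3⟩ <;> simp only [h1, h2, h3] <;>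
    by_cases h0 : 0 < F (A (σ 0)) <;> simp [h0]

end Mesh

theorem theorem1 (F : E3 → ℝ) (hF : IsSmoothCompactSurface F) (N : ℕ) (T : TetMesh N) (η : ℝ)
    (hT : IsConsistent η T (zeroSet F)) (hη : curvatureBound F * meshSize T < η) (i : Fin N) :
    -- up to the labelling of its vertices, the tetrahedron is in one of the three cases
    (∃ σ : Equiv.Perm (Fin 4), AllSame F (fun j => (T i).points (σ j)) ∨
      OneThree F (fun j => (T i).points (σ j)) ∨ TwoTwo F (fun j => (T i).points (σ j))) ∧
    -- and for every labelling `A 0, A 1, A 2, A 3` of its vertices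
    ∀ (σ : Equiv.Perm (Fin 4)) (A : Fin 4 → E3), (∀ j, A j = (T i).points (σ j)) →
      (AllSame F A → zeroSet F ∩ body (T i) = ∅) ∧
      (OneThree F A → ∀ P ∈ convexHull ℝ {A 1, A 2, A 3},
        MeetsOnce (segment ℝ (A 0) P) (zeroSet F)) ∧
      (TwoTwo F A → ∃ B : E3, segment ℝ (A 0) (A 2) ∩ zeroSet F = {B} ∧
        (∀ P ∈ convexHull ℝ {B, A 1, A 3},
          MeetsOnce (segment ℝ (A 0) P ∪ segment ℝ P (A 2)) (zeroSet F)) ∧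
        (∀ P ∈ convexHull ℝ {A 0, A 1, B}, MeetsOnce (segment ℝ (A 3) P) (zeroSet F)) ∧
        ∀ P ∈ convexHull ℝ {B, A 2, A 3}, MeetsOnce (segment ℝ (A 1) P) (zeroSet F)) := by
  have hFd : Differentiable ℝ F := hF.smooth.differentiable (by simp)
  refine ⟨?_, ?_⟩
  · exact exists_labelling F (T i).points (vertex_ne_zero hF hT hη i)
  · intro σ A hA
    have hmem : ∀ j, A j ∈ body (T i) := fun j => hA j ▸ point_mem_body _ _
    have hpos : ∀ j, 0 < F (A j) → CrossedFrom F (body (T i)) (A j) := fun j hj => by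
      rw [hA] at hj ⊢; exact crossedFrom_vertex hF hT hη i _ hj
    have hneg : ∀ j, F (A j) < 0 → CrossedFrom (-F) (body (T i)) (A j) := fun j hj => by
      rw [hA] at hj ⊢; exact crossedFrom_neg_vertex hF hT hη i _ hj
    have hconv : Convex ℝ (body (T i)) := convex_convexHull ℝ _
    have hface : ({A 1, A 2, A 3} : Set E3) ⊆ body (T i) := by
      simp [insert_subset_iff, hmem]
    have hbody : body (T i) = convexHull ℝ (range A) := by
      rw [body, show A = (T i).points ∘ σ from funext hA, σ.surjective.range_comp]
    refine ⟨?_, ?_, ?_⟩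
    · rintro (h | h)
      · refine eq_empty_of_forall_notMem fun x ⟨hx0, hx⟩ => ?_
        rw [hbody] at hx
        refine (pos_of_mem_convexHull hFd.continuous hbody.ge ?_ ?_ hx).ne' hx0
        · rintro _ ⟨j, rfl⟩; exact h j
        · rintro _ ⟨j, rfl⟩; exact hpos j (h j)
      · refine eq_empty_of_forall_notMem fun x ⟨hx0, hx⟩ => ?_
        rw [hbody] at hx
        rw [← zeroSet_neg] at hx0
        refine (pos_of_mem_convexHull (F := -F) hFd.neg.continuous hbody.ge ?_ ?_ hx).ne' hx0
        · rintro _ ⟨j, rfl⟩; simpa using h j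
        · rintro _ ⟨j, rfl⟩; exact hneg j (h j)
    · rintro (⟨h0, h1, h2, h3⟩ | ⟨h0, h1, h2, h3⟩) P hP
      · refine meetsOnce_of_one_side hFd hconv (hmem 0) hface h0 ?_ (hpos 0 h0) ?_ hP
        · simp [h1, h2, h3]
        · simp [hneg, h1, h2, h3]
      · rw [← zeroSet_neg]
        refine meetsOnce_of_one_side hFd.neg hconv (hmem 0) hface (by simpa using h0) ?_
          (hneg 0 h0) ?_ hP
        · simp [h1, h2, h3]
        · simp [hpos, h1, h2, h3]
    · rintro (⟨h0, h1, h2, h3⟩ | ⟨h0, h1, h2, h3⟩)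
      · exact exists_crossing_of_two_sides hFd hconv (hmem 0) (hmem 1) (hmem 2) (hmem 3) h0 h1 h2 h3
          (hpos 0 h0) (hpos 1 h1) (hneg 2 h2) (hneg 3 h3)
      · rw [← zeroSet_neg]
        exact exists_crossing_of_two_sides hFd.neg hconv (hmem 0) (hmem 1) (hmem 2) (hmem 3)
          (by simpa using h0) (by simpa using h1) (by simpa using h2) (by simpa using h3)
          (hneg 0 h0) (hneg 1 h1) (by rw [neg_neg]; exact hpos 2 h2)
          (by rw [neg_neg]; exact hpos 3 h3)
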